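/- Let $E_0$ be a totally real number field and $E$ a totally imaginary quadratic extension of $E_0$, or let $E_0=\mathbb{R}$ and $E=\mathbb{C}$; write $\alpha\mapsto\bar\alpha$ for the nontrivial element of $\mathrm{Gal}(E/E_0)$. Let $m\ge 1$, $n=2m$, and let $W$ be an $E$-vector space with a basis $e_1,\dots,e_{2n}$. Let $b$ be an $E$-bilinear form and $\psi$ a nondegenerate Hermitian form on $W$ such that, for $z=\sum z_ie_i$ and $w=\sum w_ie_i$, $$b(z,w)=\sum_{i=1}^n (z_iw_{n+i}+z_{n+i}w_i),\qquad \psi(z,w)=\sum_{i=1}^{2n}a_iz_i\bar w_i,$$ where $a_i\in E_0$ and $a_ia_{n+i}=\lambda$ for a fixed $\lambda\in E_0$ and all $1\le i\le n$. Let $W_1$ be the span of $e_1,\dots,e_n$, and let $D=\det(\psi|W_1)=a_1\cdots a_n$. Let $C$ be the Clifford algebra of $(W,b)$, normalized so that $vw+wv=b(v,w)$ for $v,w\in W$, and let $\rho\colon \mathrm{Spin}(W,b)\to \mathrm{SO}(W,b)$, $\rho(g)v=gvg^{-1}$, be the double cover. Let $G_1$ be the neutral component, for the Zariski topology over $E_0$,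 of the preimage under $\rho$ of the group $\mathrm{SO}(W,b)\cap \mathrm{SU}(W,\psi)$ (groups over $E_0$ are given by their $E_0$-valued points). The algebra $C$ acts on $\bigwedge^\bullet W_1$: for $i\le n$, $e_i$ acts by exterior multiplication by $e_i$, and $e_{n+i}$ acts by the interior product with the linear form $b(e_{n+i},\cdot)$ on $W_1$. Let $S^+=\bigwedge^{\mathrm{even}}W_1$ and $S^-=\bigwedge^{\mathrm{odd}}W_1$ be the resulting half spin representations of $G_1$ over $E$. Such a representation can be defined over $E_0$ if, as an $E[G_1]$-module, it is the extension of scalars to $E$ of an $E_0[G_1]$-module. Call an element of $E_0$ a norm if it lies in $\mathrm{Nm}_{E/E_0}(E^*)$. Then: 1. Both $S^+$ and $S^-$ can be defined over $E_0$ if and only if $(-1)^mD$ and $(-1)^mD\lambda$ are both norms. 2. $S^+$ can be defined over $E_0$ and $S^-$ cannot if and only if either $m$ is even, $(-1)^mD$ is a norm and $(-1)^mD\lambda$ is not a norm, or $m$ is odd, $(-1)^mD$ is not a norm and $(-1)^mD\lambda$ is a norm. 3. $S^-$ can be defined over $E_0$ and $S^+$ cannot if and only if either $m$ is odd, $(-1)^mD$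 is a norm and $(-1)^mD\lambda$ is not a norm, or $m$ is even, $(-1)^mD$ is not a norm and $(-1)^mD\lambda$ is a norm. 4. Neither $S^+$ nor $S^-$ can be defined over $E_0$ if and only if neither $(-1)^mD$ nor $(-1)^mD\lambda$ is a norm. -/

import Mathlib

open scoped TensorProduct

noncomputable section

namespace HalfSpin

/-! ### Polynomial functions and the Zariski topology on the rational points -/

/-- The `k`-algebra of polynomial functions on a `k`-vector space `V`:
the functions `V → k` that are polynomials in linear functionals. -/
def polyFun (k V : Type*) [Field k] [AddCommGroup V] [Module k V] : Subalgebra k (V → k) :=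
  Algebra.adjoin k (Set.range fun φ : Module.Dual k V => (φ : V → k))

/-- The Zariski topology on a `k`-vector space: the sets `p ≠ 0`, for `p` a polynomial function,
are a basis of open sets. -/
@[reducible]
def zariski (k V : Type*) [Field k] [AddCommGroup V] [Module k V] : TopologicalSpace V :=
  TopologicalSpace.generateFrom {U | ∃ p ∈ polyFun k V, U = {x | p x ≠ 0}}

theorem continuous_zariski {k V : Type*} [Field k] [AddCommGroup V] [Module k V]
    (T : V →ₗ[k] V) : @Continuous V V (zariski k V) (zariski k V) T := by
  let _ := zariski k V
  refine continuous_generateFrom_iff.2 ?_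
  rintro _ ⟨p, hp, rfl⟩
  refine TopologicalSpace.isOpen_generateFrom_of_mem ⟨fun x => p (T x), ?_, rfl⟩
  induction hp using Algebra.adjoin_induction with
  | mem q hq =>
    obtain ⟨φ, rfl⟩ := hq
    exact Algebra.subset_adjoin ⟨φ.comp T, rfl⟩
  | algebraMap r => exact (polyFun k V).algebraMap_mem r
  | add p q _ _ hp hq => exact (polyFun k V).add_mem hp hq
  | mul p q _ _ hp hq => exact (polyFun k V).mul_mem hp hq

/-! ### The forms -/

section Forms

variable {E₀ E W : Type*} [Field E₀] [Field E] [Algebra E₀ E] [AddCommGroup W] [Module E W]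
  {σ : E ≃ₐ[E₀] E} {n : ℕ}

/-- In the coordinates given by `e` (`e (inl i)` is `e_i` and `e (inr i)` is `e_{n+i}`),
`b` has the standard form `b(z, w) = ∑ᵢ (zᵢ w_{n+i} + z_{n+i} wᵢ)`. -/
def IsStandardBasis (b : LinearMap.BilinForm E W) (e : Module.Basis (Fin n ⊕ Fin n) E W) : Prop :=
  ∀ z w, b z w = ∑ i : Fin n, (e.repr z (.inl i) * e.repr w (.inr i)
    + e.repr z (.inr i) * e.repr w (.inl i))

/-- `e` is a good basis for the pair `b, ψ`: the bilinear form `b` is in standard form, the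
Hermitian form `ψ` is diagonal with diagonal entries `a r ∈ E₀`, and `aᵢ a_{n+i} = lam`
for all `i`. -/
structure IsGoodBasis (b : LinearMap.BilinForm E W) (ψ : W →ₗ[E] W →ₛₗ[(σ : E →+* E)] E)
    (e : Module.Basis (Fin n ⊕ Fin n) E W) (a : Fin n ⊕ Fin n → E₀) (lam : E₀) : Prop where
  standard : IsStandardBasis b e
  diagonal : ∀ z w, ψ z w = ∑ r, algebraMap E₀ E (a r) * e.repr z r * σ (e.repr w r)
  mul_eq : ∀ i : Fin n, a (.inl i) * a (.inr i) = lam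

/-- The group of `E`-linear automorphisms of `W` of determinant `1` that preserve `b` and `ψ`,
that is, the intersection of `SO(W, b)` and `SU(W, ψ)`. -/
def G₀ (b : LinearMap.BilinForm E W) (ψ : W →ₗ[E] W →ₛₗ[(σ : E →+* E)] E) :
    Subgroup (W ≃ₗ[E] W) where
  carrier := {T | LinearEquiv.det T = 1 ∧ (∀ v w, b (T v) (T w) = b v w) ∧
    ∀ v w, ψ (T v) (T w) = ψ v w}
  one_mem' := ⟨map_one _, fun _ _ => rfl, fun _ _ => rfl⟩
  mul_mem' := fun {S T} hS hT => ⟨by rw [map_mul, hS.1, hT.1, one_mul],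
    fun v w => (hS.2.1 _ _).trans (hT.2.1 v w), fun v w => (hS.2.2 _ _).trans (hT.2.2 v w)⟩
  inv_mem' := fun {T} hT => ⟨by rw [map_inv, hT.1, inv_one],
    fun v w => by
      have h := hT.2.1 (T⁻¹ v) (T⁻¹ w)
      rw [← LinearEquiv.mul_apply, ← LinearEquiv.mul_apply, mul_inv_cancel] at h
      exact h.symm,
    fun v w => by
      have h := hT.2.2 (T⁻¹ v) (T⁻¹ w)
      rw [← LinearEquiv.mul_apply, ← LinearEquiv.mul_apply, mul_inv_cancel] at h
      exact h.symm⟩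

/-! ### The Clifford algebra and the group `G₁` -/

/-- The quadratic form `v ↦ b(v, v) / 2`.  In its Clifford algebra `v w + w v = b(v, w)`; in
particular `eᵢ e_{n+i} + e_{n+i} eᵢ = 1` in a standard basis. -/
def quad (b : LinearMap.BilinForm E W) : QuadraticForm E W :=
  ((2 : E)⁻¹ • b).toQuadraticMap

/-- The preimage of `G₀ b ψ` under the double cover `ρ : Spin(W, b) → SO(W, b)`, where
`ρ(g) v = g v g⁻¹`. -/
def preimageG₀ (b : LinearMap.BilinForm E W) (ψ : W →ₗ[E] W →ₛₗ[(σ : E →+* E)] E) :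
    Subgroup (spinGroup (quad b)) where
  carrier := {g | ∃ T ∈ G₀ b ψ, ∀ v, (g : CliffordAlgebra (quad b)) *
    CliffordAlgebra.ι (quad b) v = CliffordAlgebra.ι (quad b) (T v) * (g : CliffordAlgebra (quad b))}
  one_mem' := ⟨1, one_mem _, fun v => by simp⟩
  mul_mem' := by
    rintro g h ⟨S, hS, hgS⟩ ⟨T, hT, hhT⟩
    refine ⟨S * T, mul_mem hS hT, fun v => ?_⟩
    rw [Submonoid.coe_mul, mul_assoc, hhT, ← mul_assoc, hgS, mul_assoc, LinearEquiv.mul_apply]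
  inv_mem' := by
    rintro g ⟨T, hT, hgT⟩
    refine ⟨T⁻¹, inv_mem hT, fun v => ?_⟩
    have h1 : ((g⁻¹ : spinGroup (quad b)) : CliffordAlgebra (quad b)) * g = 1 := by
      rw [← Submonoid.coe_mul, inv_mul_cancel, Submonoid.coe_one]
    have h2 : (g : CliffordAlgebra (quad b)) * (g⁻¹ : spinGroup (quad b)) = 1 := by
      rw [← Submonoid.coe_mul, mul_inv_cancel, Submonoid.coe_one]
    have h := hgT (T⁻¹ v)
    rw [← LinearEquiv.mul_apply, mul_inv_cancel, LinearEquiv.coe_one, id] at h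
    calc _ = ((g⁻¹ : spinGroup (quad b)) : CliffordAlgebra (quad b)) *
          (CliffordAlgebra.ι (quad b) v * (g : CliffordAlgebra (quad b))) * (g⁻¹ : spinGroup (quad b)) := by
            rw [mul_assoc, mul_assoc, h2, mul_one]
      _ = _ := by rw [← h, ← mul_assoc, h1, one_mul]

variable [Module E₀ W] [IsScalarTower E₀ E W]

/-- The topology on `Spin(W, b)` induced by the Zariski topology of the Clifford algebra, which
is regarded as a vector space over `E₀` (not over `E`). -/
@[reducible]
def spinZariski (E₀ : Type*) {E W : Type*} [Field E₀] [Field E] [Algebra E₀ E]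
    [AddCommGroup W] [Module E W] [Module E₀ W] [IsScalarTower E₀ E W]
    (b : LinearMap.BilinForm E W) : TopologicalSpace (spinGroup (quad b)) :=
  (zariski E₀ (CliffordAlgebra (quad b))).induced Subtype.val

theorem continuous_mul_left (b : LinearMap.BilinForm E W) (g : spinGroup (quad b)) :
    @Continuous _ _ (spinZariski E₀ b) (spinZariski E₀ b) (fun h => g * h) := by
  let _ := zariski E₀ (CliffordAlgebra (quad b))
  let _ := spinZariski E₀ b
  refine continuous_induced_rng.2 ?_
  exact (continuous_zariski
    (LinearMap.mulLeft E₀ (g : CliffordAlgebra (quad b)))).comp continuous_induced_dom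

/-- The group `G₁`: the neutral component, for the Zariski topology over `E₀`, of the preimage of
`G₀ b ψ` in `Spin(W, b)`. -/
def G₁ (b : LinearMap.BilinForm E W) (ψ : W →ₗ[E] W →ₛₗ[(σ : E →+* E)] E) :
    Subgroup (spinGroup (quad b)) :=
  letI := spinZariski E₀ b
  have key : ∀ g ∈ connectedComponentIn (preimageG₀ b ψ : Set (spinGroup (quad b))) 1,
      ∀ h ∈ connectedComponentIn (preimageG₀ b ψ : Set (spinGroup (quad b))) 1,
      g⁻¹ * h ∈ connectedComponentIn (preimageG₀ b ψ : Set (spinGroup (quad b))) 1 := by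
    intro g hg h hh
    have hP := connectedComponentIn_subset (preimageG₀ b ψ : Set (spinGroup (quad b))) 1
    have hc := (isPreconnected_connectedComponentIn
      (F := (preimageG₀ b ψ : Set (spinGroup (quad b)))) (x := 1)).image (fun h => g⁻¹ * h)
      (continuous_mul_left (E₀ := E₀) b g⁻¹).continuousOn
    refine hc.subset_connectedComponentIn ⟨g, hg, inv_mul_cancel g⟩ ?_ ⟨h, hh, rfl⟩
    rintro _ ⟨x, hx, rfl⟩
    exact mul_mem (inv_mem (hP hg)) (hP hx)
  have one : (1 : spinGroup (quad b)) ∈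
      connectedComponentIn (preimageG₀ b ψ : Set (spinGroup (quad b))) 1 :=
    mem_connectedComponentIn (one_mem (preimageG₀ b ψ))
  { carrier := connectedComponentIn (preimageG₀ b ψ : Set (spinGroup (quad b))) 1
    one_mem' := one
    inv_mem' := fun {g} hg => by simpa using key g hg 1 one
    mul_mem' := fun {g h} hg hh => by
      simpa using key g⁻¹ (by simpa using key g hg 1 one) h hh }

end Forms

/-! ### The half spin representations -/

section Spinors

variable {E W : Type*} [Field E] [AddCommGroup W] [Module E W] {n : ℕ}

/-- The isotropic subspace `W₁`, spanned by `e₁, …, eₙ`. -/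
def W₁ (e : Module.Basis (Fin n ⊕ Fin n) E W) : Submodule E W :=
  Submodule.span E (Set.range fun i : Fin n => e (.inl i))

/-- The projection of `W` onto `W₁` along the span of `e_{n+1}, …, e_{2n}`. -/
def projW₁ (e : Module.Basis (Fin n ⊕ Fin n) E W) : W →ₗ[E] W₁ e :=
  e.constr E (Sum.elim (fun i => ⟨e (.inl i), Submodule.subset_span ⟨i, rfl⟩⟩) fun _ => 0)

/-- The action of `w ∈ W` on the exterior algebra of `W₁`: exterior multiplication by the
component of `w` in `W₁`, plus contraction with the linear form `b(w, ·)` on `W₁`, so that `eᵢ`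
acts by exterior multiplication and `e_{n+i}` by the interior product. -/
def vectorAction (b : LinearMap.BilinForm E W) (e : Module.Basis (Fin n ⊕ Fin n) E W) :
    W →ₗ[E] Module.End E (ExteriorAlgebra E (W₁ e)) :=
  (LinearMap.mul E (ExteriorAlgebra E (W₁ e))) ∘ₗ ExteriorAlgebra.ι E ∘ₗ projW₁ e +
    CliffordAlgebra.contractLeft ∘ₗ (W₁ e).subtype.dualMap ∘ₗ b

theorem vectorAction_apply (b : LinearMap.BilinForm E W) (e : Module.Basis (Fin n ⊕ Fin n) E W)
    (w : W) (x : ExteriorAlgebra E (W₁ e)) : vectorAction b e w x =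
      ExteriorAlgebra.ι E (projW₁ e w) * x +
        CliffordAlgebra.contractLeft ((W₁ e).subtype.dualMap (b w)) x := rfl

theorem repr_projW₁ (e : Module.Basis (Fin n ⊕ Fin n) E W) (w : W) :
    (projW₁ e w : W) = ∑ i : Fin n, e.repr w (.inl i) • e (.inl i) := by
  simp [projW₁, Module.Basis.constr_apply_fintype, Module.Basis.equivFun_apply]

theorem b_projW₁ [NeZero (2 : E)] {b : LinearMap.BilinForm E W}
    {e : Module.Basis (Fin n ⊕ Fin n) E W} (h : IsStandardBasis b e) (w : W) :
    b w (projW₁ e w) = quad b w := by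
  have h2 : (2 : E) ≠ 0 := NeZero.ne 2
  have h1 : b w (projW₁ e w) = ∑ i : Fin n, e.repr w (.inl i) * e.repr w (.inr i) := by
    rw [h, repr_projW₁]
    refine Finset.sum_congr rfl fun i _ => ?_
    simp [Finsupp.single_apply, mul_comm]
  have h3 : quad b w = 2⁻¹ * b w w := rfl
  rw [h1, h3, h w w, Finset.mul_sum]
  refine Finset.sum_congr rfl fun i _ => ?_
  field_simp
  ring

theorem vectorAction_sq [NeZero (2 : E)] {b : LinearMap.BilinForm E W}
    {e : Module.Basis (Fin n ⊕ Fin n) E W} (h : IsStandardBasis b e) (w : W) :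
    vectorAction b e w * vectorAction b e w = algebraMap E _ (quad b w) := by
  refine LinearMap.ext fun x => ?_
  rw [Module.End.mul_apply, vectorAction_apply, vectorAction_apply, map_add,
    CliffordAlgebra.contractLeft_contractLeft, CliffordAlgebra.contractLeft_ι_mul, mul_add,
    ← mul_assoc, ExteriorAlgebra.ι_sq_zero, zero_mul, zero_add, add_zero,
    Module.algebraMap_end_apply, ← b_projW₁ h]
  change _ + (b w (projW₁ e w) • x - _) = _
  exact add_sub_cancel _ _

/-- The spin module: the algebra homomorphism from the Clifford algebra to the endomorphisms of
the exterior algebra of `W₁`. -/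
def spinAction [NeZero (2 : E)] {b : LinearMap.BilinForm E W}
    {e : Module.Basis (Fin n ⊕ Fin n) E W} (h : IsStandardBasis b e) :
    CliffordAlgebra (quad b) →ₐ[E] Module.End E (ExteriorAlgebra E (W₁ e)) :=
  CliffordAlgebra.lift _ ⟨vectorAction b e, vectorAction_sq h⟩

/-- The even (`ε = 0`) or odd (`ε = 1`) part of the exterior algebra of `W₁`. -/
abbrev S (e : Module.Basis (Fin n ⊕ Fin n) E W) (ε : ZMod 2) :
    Submodule E (ExteriorAlgebra E (W₁ e)) :=
  CliffordAlgebra.evenOdd (0 : QuadraticForm E (W₁ e)) ε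

theorem contractLeft_mem {M : Type*} [AddCommGroup M] [Module E M] (Q : QuadraticForm E M)
    (d : Module.Dual E M) {ε : ZMod 2} {x : CliffordAlgebra Q}
    (hx : x ∈ CliffordAlgebra.evenOdd Q ε) :
    CliffordAlgebra.contractLeft d x ∈ CliffordAlgebra.evenOdd Q (1 + ε) := by
  induction hx using Submodule.iSup_induction' with
  | mem i x hx =>
    obtain ⟨i, rfl⟩ := i
    dsimp only [Subtype.coe_mk] at hx
    induction hx using Submodule.pow_induction_on_left' with
    | algebraMap r =>
      rw [CliffordAlgebra.contractLeft_algebraMap]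
      exact zero_mem _
    | add x y i hx hy ihx ihy =>
      rw [map_add]
      exact add_mem ihx ihy
    | mem_mul v hv i x hx ih =>
      obtain ⟨v, rfl⟩ := hv
      rw [CliffordAlgebra.contractLeft_ι_mul]
      have h2 : (1 : ZMod 2) + ((i.succ : ℕ) : ZMod 2) = (i : ZMod 2) := by
        have h : (1 : ZMod 2) + 1 = 0 := by decide
        rw [Nat.succ_eq_add_one, Nat.cast_add, Nat.cast_one, add_comm (i : ZMod 2), ← add_assoc, h,
          zero_add]
      have h3 : ((i.succ : ℕ) : ZMod 2) = 1 + (i : ZMod 2) := by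
        rw [Nat.succ_eq_add_one, Nat.cast_add, Nat.cast_one, add_comm]
      refine sub_mem (Submodule.smul_mem _ _ ?_) ?_
      · rw [h2]
        exact Submodule.mem_iSup_of_mem ⟨i, rfl⟩ hx
      · rw [h3]
        exact SetLike.mul_mem_graded (CliffordAlgebra.ι_mem_evenOdd_one Q v) ih
  | zero =>
    rw [map_zero]
    exact zero_mem _
  | add x y hx hy ihx ihy =>
    rw [map_add]
    exact add_mem ihx ihy

theorem vectorAction_mem (b : LinearMap.BilinForm E W) (e : Module.Basis (Fin n ⊕ Fin n) E W)
    (w : W) {ε : ZMod 2} {x : ExteriorAlgebra E (W₁ e)} (hx : x ∈ S e ε) :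
    vectorAction b e w x ∈ S e (1 + ε) := by
  rw [vectorAction_apply]
  exact add_mem (SetLike.mul_mem_graded (CliffordAlgebra.ι_mem_evenOdd_one _ _) hx)
    (contractLeft_mem _ _ hx)

theorem spinAction_mem [NeZero (2 : E)] {b : LinearMap.BilinForm E W}
    {e : Module.Basis (Fin n ⊕ Fin n) E W} (h : IsStandardBasis b e)
    {g : CliffordAlgebra (quad b)} (hg : g ∈ CliffordAlgebra.evenOdd (quad b) 0)
    {ε : ZMod 2} {x : ExteriorAlgebra E (W₁ e)} (hx : x ∈ S e ε) :
    spinAction h g x ∈ S e ε := by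
  induction g, hg using CliffordAlgebra.even_induction with
  | algebraMap r =>
    rw [AlgHom.commutes, Module.algebraMap_end_apply]
    exact Submodule.smul_mem _ _ hx
  | add y z hy hz ihy ihz =>
    rw [map_add, LinearMap.add_apply]
    exact add_mem ihy ihz
  | ι_mul_ι_mul v w y hy ih =>
    have h2 : (1 : ZMod 2) + (1 + ε) = ε := by
      have h : (1 : ZMod 2) + 1 = 0 := by decide
      rw [← add_assoc, h, zero_add]
    rw [map_mul, map_mul, spinAction, CliffordAlgebra.lift_ι_apply, CliffordAlgebra.lift_ι_apply,
      Module.End.mul_apply, Module.End.mul_apply]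
    have := vectorAction_mem b e v (vectorAction_mem b e w ih)
    rwa [h2] at this

/-- The half spin representations of `Spin(W, b)` attached to the basis `e`: the spin module
restricted to `S⁺ = ⋀^even W₁` (`ε = 0`) and to `S⁻ = ⋀^odd W₁` (`ε = 1`). -/
def halfSpin [NeZero (2 : E)] {b : LinearMap.BilinForm E W}
    {e : Module.Basis (Fin n ⊕ Fin n) E W} (h : IsStandardBasis b e) (ε : ZMod 2) :
    Representation E (spinGroup (quad b)) (S e ε) where
  toFun g := (spinAction h (g : CliffordAlgebra (quad b))).restrict
    (fun _ hx => spinAction_mem h (spinGroup.mem_even g.2) hx)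
  map_one' := by
    ext x
    simp
  map_mul' g g' := by
    ext x
    simp

/-- The half spin representations `S⁺` (`ε = 0`) and `S⁻` (`ε = 1`) of `G₁`, over `E`. -/
def halfSpinG₁ {E₀ : Type*} [Field E₀] [Algebra E₀ E] [Module E₀ W] [IsScalarTower E₀ E W]
    [NeZero (2 : E)] {σ : E ≃ₐ[E₀] E} {b : LinearMap.BilinForm E W}
    (ψ : W →ₗ[E] W →ₛₗ[(σ : E →+* E)] E) {e : Module.Basis (Fin n ⊕ Fin n) E W}
    (h : IsStandardBasis b e) (ε : ZMod 2) : Representation E (G₁ b ψ) (S e ε) :=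
  (halfSpin h ε).comp (G₁ b ψ).subtype

end Spinors

/-! ### Rationality -/

/-- A finite-dimensional representation `ρ` of `G` over `K` can be defined over the subfield `k`:
it is isomorphic to the extension of scalars of a representation of `G` over `k`. -/
def DefinedOver (k : Type*) {K G V : Type*} [Field k] [Field K] [Algebra k K] [Group G]
    [AddCommGroup V] [Module K V] (ρ : Representation K G V) : Prop :=
  ∃ (d : ℕ) (ρ₀ : Representation k G (Fin d → k)) (Φ : (K ⊗[k] (Fin d → k)) ≃ₗ[K] V),
    ∀ g x, Φ ((ρ₀ g).baseChange K x) = ρ g (Φ x)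

/-- `x ∈ k` is a norm, that is, lies in `Nm_{K/k}(Kˣ)`. -/
def IsNorm {k : Type*} (K : Type*) [Field k] [Field K] [Algebra k K] (x : k) : Prop :=
  ∃ c : Kˣ, Algebra.norm k (c : K) = x

end HalfSpin

/-! Let `J` be the `σ`-semilinear map with `ψ(z, w) = b(z, J w)`. Elements of `G₀` commute with `J`,
and `J² = λ`, `b(Jv, Jw) = λ σ(b(v, w))`. So `J` is a similitude of factor `λ` and does not extend
to the Clifford algebra of `b`, but `vw ↦ λ⁻¹ J(v) J(w)` does make sense on its even part. On the
spin module this is implemented by a semilinear `F` with `F(v x) = J(v) F(x)` for even `x` and `F(v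
x) = λ⁻¹ J(v) F(x)` for odd `x`. It exists because `1` is, up to scalars, the vector killed by all
`e_{n+i}`, and the top form, killed by all `J(e_{n+i})`, can serve as `F(1)`. The top form is even
since `n = 2m`, so `F` preserves `S⁺` and `S⁻`. Applying `F` to the top form shows that `F²` is `c =
(-1)^m D λ^{-m}` on `S⁺` and `c λ` on `S⁻` (`exists_spinJ`).

An element of the preimage of `G₀` commutes with `F` up to a scalar by Schur's lemma, and comparison
with the Clifford involution shows that the scalar is `±1`. The sign is constant on the neutral
component, so `G₁` commutes with `F` (`commute_G₁`).

If the scalar of `F²` on a half spin module is `u σ(u)`, then `u⁻¹ F` is an involution commuting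
with `G₁`, and Galois descent gives an `E₀`-form. Conversely an `E₀`-form gives a semilinear
involution `j` commuting with `G₁`. Then `j F` is linear and commutes with `G₁`, hence is a scalar
`u`, and `F² = u σ(u)`. This last use of Schur's lemma requires `G₁` to be large enough: it contains
rational curves of torus elements, whose commutant centralizes the even Clifford algebra
(`commute_vectorAction_basis`, `exists_smul_of_commute_G₁`).

Thus each half spin module is defined over `E₀` exactly when its scalar is a norm
(`definedOver_halfSpinG₁_iff`). Squares of `E₀` are norms, so only the parity of the exponent of `λ`
matters, which is where the parity of `m` enters. -/

namespace HalfSpin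

/-! ### The spin module as a Fock space: universal property, Schur's lemma, faithfulness -/

section Fock

variable {E W : Type*} [Field E] [AddCommGroup W] [Module E W] {n : ℕ}
  {b : LinearMap.BilinForm E W} {e : Module.Basis (Fin n ⊕ Fin n) E W}

namespace IsStandardBasis

theorem symm (h : IsStandardBasis b e) (v w : W) : b v w = b w v := by
  rw [h, h]
  exact Finset.sum_congr rfl fun i _ => by ring

theorem apply_basis_left (h : IsStandardBasis b e) (r : Fin n ⊕ Fin n) (w : W) :
    b (e r) w = e.repr w r.swap := by
  rw [h]
  cases r <;> simp [Finsupp.single_apply]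

theorem eq_zero (h : IsStandardBasis b e) {w : W} (hw : ∀ v, b v w = 0) : w = 0 := by
  refine e.ext_elem fun r => ?_
  rw [← Sum.swap_swap r, ← h.apply_basis_left, hw, map_zero, Finsupp.zero_apply]

theorem polar_quad [NeZero (2 : E)] (h : IsStandardBasis b e) (v w : W) :
    QuadraticMap.polar (quad b) v w = b v w := by
  have h2 : (2 : E) ≠ 0 := NeZero.ne 2
  have hq : ∀ u, quad b u = 2⁻¹ * b u u := fun _ => rfl
  rw [QuadraticMap.polar, hq, hq, hq, map_add, map_add, LinearMap.add_apply, LinearMap.add_apply,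
    h.symm w v]
  field_simp
  ring

theorem quad_eq [NeZero (2 : E)] (b : LinearMap.BilinForm E W) (v : W) :
    quad b v = 2⁻¹ * b v v := rfl

theorem ι_anticomm [NeZero (2 : E)] (h : IsStandardBasis b e) (v w : W) :
    CliffordAlgebra.ι (quad b) v * CliffordAlgebra.ι (quad b) w +
      CliffordAlgebra.ι (quad b) w * CliffordAlgebra.ι (quad b) v =
      algebraMap E _ (b v w) := by
  rw [CliffordAlgebra.ι_mul_ι_add_swap, h.polar_quad]

end IsStandardBasis

theorem spinAction_ι [NeZero (2 : E)] (h : IsStandardBasis b e) (v : W) :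
    spinAction h (CliffordAlgebra.ι (quad b) v) = vectorAction b e v :=
  CliffordAlgebra.lift_ι_apply _ _ _

theorem vectorAction_anticomm [NeZero (2 : E)] (h : IsStandardBasis b e) (v w : W)
    (x : ExteriorAlgebra E (W₁ e)) :
    vectorAction b e v (vectorAction b e w x) + vectorAction b e w (vectorAction b e v x) =
      b v w • x := by
  have := LinearMap.congr_fun (congrArg (spinAction h) (h.ι_anticomm v w)) x
  simpa only [map_add, map_mul, spinAction_ι, AlgHom.commutes, Module.algebraMap_end_apply,
    LinearMap.add_apply, Module.End.mul_apply] using this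

theorem projW₁_coe (e : Module.Basis (Fin n ⊕ Fin n) E W) (m : W₁ e) : projW₁ e m = m := by
  obtain ⟨m, hm⟩ := m
  induction hm using Submodule.span_induction with
  | mem x hx =>
    obtain ⟨i, rfl⟩ := hx
    simp [projW₁]
  | zero => exact map_zero _
  | add x y hx hy ihx ihy =>
    have : (⟨x + y, (W₁ e).add_mem hx hy⟩ : W₁ e) = ⟨x, hx⟩ + ⟨y, hy⟩ := rfl
    rw [this, Submodule.coe_add, map_add, ihx, ihy]
  | smul c x hx ihx =>
    have : (⟨c • x, (W₁ e).smul_mem c hx⟩ : W₁ e) = c • ⟨x, hx⟩ := rfl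
    rw [this, Submodule.coe_smul, map_smul, ihx]

theorem projW₁_inr (e : Module.Basis (Fin n ⊕ Fin n) E W) (i : Fin n) :
    projW₁ e (e (.inr i)) = 0 := by
  simp [projW₁]

theorem W₁_isotropic (h : IsStandardBasis b e) (m m' : W₁ e) : b (m : W) m' = 0 := by
  rw [← projW₁_coe e m, ← projW₁_coe e m', repr_projW₁, repr_projW₁]
  simp [h.apply_basis_left]

theorem vectorAction_coe (h : IsStandardBasis b e) (m : W₁ e) (x : ExteriorAlgebra E (W₁ e)) :
    vectorAction b e m x = ExteriorAlgebra.ι E m * x := by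
  have : (W₁ e).subtype.dualMap (b (m : W)) = 0 :=
    LinearMap.ext fun m' => W₁_isotropic h m m'
  rw [vectorAction_apply, projW₁_coe, this, map_zero, LinearMap.zero_apply, add_zero]

theorem vectorAction_inr_algebraMap (i : Fin n) (c : E) :
    vectorAction b e (e (.inr i)) (algebraMap E (ExteriorAlgebra E (W₁ e)) c) = 0 := by
  rw [vectorAction_apply, projW₁_inr, map_zero, zero_mul, zero_add]
  exact CliffordAlgebra.contractLeft_algebraMap (0 : QuadraticForm E (W₁ e)) _ _

theorem vectorAction_inr_one (i : Fin n) :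
    vectorAction b e (e (.inr i)) (1 : ExteriorAlgebra E (W₁ e)) = 0 := by
  rw [← map_one (algebraMap E (ExteriorAlgebra E (W₁ e))), vectorAction_inr_algebraMap]

/-- The exterior algebra of `W₁` is generated from the scalars by the action of `W₁`. -/
@[elab_as_elim]
theorem spinor_induction (h : IsStandardBasis b e) {P : ExteriorAlgebra E (W₁ e) → Prop}
    (algebraMap : ∀ c : E, P (algebraMap E _ c)) (add : ∀ x y, P x → P y → P (x + y))
    (vector : ∀ (m : W₁ e) x, P x → P (vectorAction b e m x)) (x : ExteriorAlgebra E (W₁ e)) :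
    P x := by
  induction x using CliffordAlgebra.left_induction with
  | algebraMap r => exact algebraMap r
  | add x y hx hy => exact add x y hx hy
  | ι_mul x m hx =>
    have := vector m x hx
    rwa [vectorAction_coe h] at this

theorem eq_projW₁_add (e : Module.Basis (Fin n ⊕ Fin n) E W) (v : W) :
    v = projW₁ e v + ∑ i : Fin n, e.repr v (.inr i) • e (.inr i) := by
  conv_lhs => rw [← e.sum_repr v, Fintype.sum_sum_type]
  rw [repr_projW₁]

/-- The universal property of the spin module: a Clifford module with a vector killed by
all `e_{n+i}` receives a map from the exterior algebra of `W₁`. -/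
theorem exists_linear_of_vacuum [NeZero (2 : E)] (h : IsStandardBasis b e) {M : Type*}
    [AddCommGroup M] [Module E M] (G : W →ₗ[E] Module.End E M)
    (hG : ∀ v, G v * G v = algebraMap E _ (quad b v)) (ω : M)
    (hω : ∀ i, G (e (.inr i)) ω = 0) :
    ∃ F : ExteriorAlgebra E (W₁ e) →ₗ[E] M, F 1 = ω ∧
      ∀ v x, F (vectorAction b e v x) = G v (F x) := by
  -- Polarization of `hG`.
  have hanti : ∀ v w y, G v (G w y) + G w (G v y) = b v w • y := by
    intro v w y
    have h1 := LinearMap.congr_fun (hG (v + w)) y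
    have h2 := LinearMap.congr_fun (hG v) y
    have h3 := LinearMap.congr_fun (hG w) y
    have h4 := h.polar_quad v w
    simp only [map_add, Module.End.mul_apply, LinearMap.add_apply, Module.algebraMap_end_apply]
      at h1 h2 h3
    rw [← h4, QuadraticMap.polar, sub_smul, sub_smul, ← h1, ← h2, ← h3]
    abel
  have hsq : ∀ m : W₁ e, (G ∘ₗ (W₁ e).subtype) m * (G ∘ₗ (W₁ e).subtype) m = 0 := by
    intro m
    change G m * G m = 0
    rw [hG, IsStandardBasis.quad_eq, W₁_isotropic h, mul_zero, map_zero]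
  -- `W₁` is isotropic, so `G` restricted to it squares to zero and extends to the exterior algebra.
  -- The required map is `x ↦ A(x) ω`.
  let A := ExteriorAlgebra.lift E ⟨G ∘ₗ (W₁ e).subtype, hsq⟩
  have hA : ∀ m : W₁ e, A (ExteriorAlgebra.ι E m) = G m := fun m =>
    ExteriorAlgebra.lift_ι_apply E _ _ m
  have hF1 : ∀ (m : W₁ e) x, A (vectorAction b e m x) ω = G m (A x ω) := by
    intro m x
    rw [vectorAction_coe h, map_mul, hA, Module.End.mul_apply]
  -- Move `e_{n+i}` to the right through vectors of `W₁` until it reaches the vacuum, where both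
  -- sides vanish.
  have hF2 : ∀ i x, A (vectorAction b e (e (.inr i)) x) ω = G (e (.inr i)) (A x ω) := by
    intro i x
    induction x using spinor_induction h with
    | algebraMap c =>
      rw [vectorAction_inr_algebraMap, AlgHom.commutes, Module.algebraMap_end_apply, map_smul,
        hω, map_zero, smul_zero, LinearMap.zero_apply]
    | add x y hx hy => rw [map_add, map_add, LinearMap.add_apply, hx, hy, map_add,
        LinearMap.add_apply, map_add]
    | vector m x hx =>
      rw [eq_sub_of_add_eq (vectorAction_anticomm h (e (.inr i)) m x), map_sub,
        LinearMap.sub_apply, map_smul, LinearMap.smul_apply, hF1, hx, hF1,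
        eq_sub_of_add_eq (hanti (e (.inr i)) m _)]
  refine ⟨A.toLinearMap.flip ω, ?_, fun v x => ?_⟩
  · change A 1 ω = ω
    rw [map_one, Module.End.one_apply]
  · change A (vectorAction b e v x) ω = G v (A x ω)
    rw [eq_projW₁_add e v, map_add, LinearMap.add_apply, map_add, LinearMap.add_apply, hF1,
      map_add, LinearMap.add_apply]
    simp only [map_sum, map_smul, LinearMap.sum_apply, LinearMap.smul_apply, hF2]

/-- A copy of `M`, on which the scalars act through `σ`. -/
def Twist {E : Type*} [Field E] (_ : E →+* E) (M : Type*) : Type _ := M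

instance {σ : E →+* E} {M : Type*} [AddCommGroup M] : AddCommGroup (Twist σ M) :=
  inferInstanceAs (AddCommGroup M)

instance {σ : E →+* E} {M : Type*} [AddCommGroup M] [Module E M] : Module E (Twist σ M) :=
  Module.compHom M σ

/-- Absorbing `σ` into the scalar action on the target turns this into the linear case. -/
theorem exists_semilinear_of_vacuum [NeZero (2 : E)] (h : IsStandardBasis b e) (σ : E →+* E)
    {M : Type*} [AddCommGroup M] [Module E M] (G : W →ₛₗ[σ] Module.End E M)
    (hG : ∀ v, G v * G v = algebraMap E _ (σ (quad b v))) (ω : M)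
    (hω : ∀ i, G (e (.inr i)) ω = 0) :
    ∃ F : ExteriorAlgebra E (W₁ e) →ₛₗ[σ] M, F 1 = ω ∧
      ∀ v x, F (vectorAction b e v x) = G v (F x) := by
  let G' : W →ₗ[E] Module.End E (Twist σ M) :=
    { toFun v :=
        { toFun := G v
          map_add' := (G v).map_add
          map_smul' := fun c x => (G v).map_smul (σ c) x }
      map_add' v w := LinearMap.ext fun x => LinearMap.congr_fun (G.map_add v w) x
      map_smul' c v := LinearMap.ext fun x => LinearMap.congr_fun (G.map_smulₛₗ c v) x }
  obtain ⟨F, h1, h2⟩ := exists_linear_of_vacuum h (M := Twist σ M) G'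
    (fun v => LinearMap.ext fun x => LinearMap.congr_fun (hG v) x) ω hω
  exact ⟨{ toFun := F, map_add' := F.map_add, map_smul' := fun c x => F.map_smul c x }, h1, h2⟩

/-- The spin module contains, up to scalars, only one vector killed by all `e_{n+i}`. -/
theorem exists_algebraMap_of_vacuum [NeZero (2 : E)] (h : IsStandardBasis b e)
    {x : ExteriorAlgebra E (W₁ e)} (hx : ∀ i, vectorAction b e (e (.inr i)) x = 0) :
    ∃ c, x = algebraMap E _ c := by
  -- The product of the `N i` over all `i` is the projection onto the vacuum line: it fixes vacuum
  -- vectors and sends everything to scalars.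
  let N : Fin n → Module.End E (ExteriorAlgebra E (W₁ e)) := fun i =>
    vectorAction b e (e (.inr i)) * vectorAction b e (e (.inl i))
  have hN : ∀ l : List (Fin n), (l.map N).prod x = x := by
    intro l
    induction l with
    | nil => rfl
    | cons i l ih =>
      have := vectorAction_anticomm h (e (.inr i)) (e (.inl i)) x
      rw [hx, map_zero, add_zero, h.apply_basis_left] at this
      rw [List.map_cons, List.prod_cons, Module.End.mul_apply, ih, Module.End.mul_apply, this]
      simp
  -- `N i` commutes with `e_j` for `i ≠ j`, and `N j e_j = 0` because `e_j² = 0`.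
  have hz : ∀ j (l : List (Fin n)) y, ∃ z, (l.map N).prod (vectorAction b e (e (.inl j)) y) =
      vectorAction b e (e (.inl j)) z ∧ (j ∈ l → z = 0) := by
    intro j l y
    induction l with
    | nil => exact ⟨y, rfl, fun hj => absurd hj List.not_mem_nil⟩
    | cons i l ih =>
      obtain ⟨z, hz, hz0⟩ := ih
      rw [List.map_cons, List.prod_cons, Module.End.mul_apply, hz, Module.End.mul_apply]
      by_cases hij : i = j
      · subst hij
        refine ⟨0, ?_, fun _ => rfl⟩
        have := LinearMap.congr_fun (vectorAction_sq h (e (.inl i))) z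
        rw [Module.End.mul_apply, IsStandardBasis.quad_eq, h.apply_basis_left] at this
        rw [this]
        simp
      · refine ⟨N i z, ?_, fun hj => ?_⟩
        · have h1 := vectorAction_anticomm h (e (.inl i)) (e (.inl j)) z
          have h2 := vectorAction_anticomm h (e (.inr i)) (e (.inl j))
            (vectorAction b e (e (.inl i)) z)
          rw [h.apply_basis_left] at h1 h2
          simp only [Sum.swap_inl, Module.Basis.repr_self, ne_eq, reduceCtorEq,
            not_false_eq_true, Finsupp.single_eq_of_ne, zero_smul] at h1
          rw [Sum.swap_inr, Module.Basis.repr_self, Finsupp.single_eq_of_ne (by simpa using hij),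
            zero_smul] at h2
          rw [eq_neg_of_add_eq_zero_left h1, map_neg, eq_neg_of_add_eq_zero_left h2, neg_neg]
          rfl
        · rw [hz0 ((List.mem_cons.1 hj).resolve_left (Ne.symm hij)), map_zero]
  have key : ∀ y, ∃ c, ((List.finRange n).map N).prod y = algebraMap E _ c := by
    intro y
    induction y using spinor_induction h with
    | algebraMap c =>
      refine ⟨c, ?_⟩
      induction List.finRange n with
      | nil => rfl
      | cons i l ih =>
        have := vectorAction_anticomm h (e (.inr i)) (e (.inl i)) (algebraMap E _ c)
        rw [vectorAction_inr_algebraMap, map_zero, add_zero, h.apply_basis_left] at this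
        rw [List.map_cons, List.prod_cons, Module.End.mul_apply, ih, Module.End.mul_apply, this]
        simp
    | add y z hy hz =>
      obtain ⟨c, hc⟩ := hy
      obtain ⟨d, hd⟩ := hz
      exact ⟨c + d, by rw [map_add, hc, hd, map_add]⟩
    | vector m y _ =>
      refine ⟨0, ?_⟩
      rw [← projW₁_coe e m, repr_projW₁, map_sum, LinearMap.sum_apply, map_sum, map_zero]
      refine Finset.sum_eq_zero fun j _ => ?_
      obtain ⟨z, hz, hz0⟩ := hz j (List.finRange n) y
      rw [map_smul, LinearMap.smul_apply, map_smul, hz, hz0 (List.mem_finRange j), map_zero,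
        smul_zero]
  obtain ⟨c, hc⟩ := key x
  exact ⟨c, by rw [← hc, hN]⟩

/-- The vector `1` generates the spin module, so a map with prescribed behaviour under vectors is
determined by its value there. -/
theorem linearMap_ext_of_vectorAction (h : IsStandardBasis b e) {σ : E →+* E} {M : Type*}
    [AddCommGroup M] [Module E M] {F F' : ExteriorAlgebra E (W₁ e) →ₛₗ[σ] M}
    (G : W → M → M) (h1 : F 1 = F' 1) (hF : ∀ v x, F (vectorAction b e v x) = G v (F x))
    (hF' : ∀ v x, F' (vectorAction b e v x) = G v (F' x)) : F = F' := by
  refine LinearMap.ext fun x => ?_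
  induction x using spinor_induction h with
  | algebraMap c => rw [Algebra.algebraMap_eq_smul_one, map_smulₛₗ, map_smulₛₗ, h1]
  | add x y hx hy => rw [map_add, map_add, hx, hy]
  | vector m x hx => rw [hF, hF', hx]

/-- Schur's lemma for the spin module. -/
theorem exists_smul_of_commute [NeZero (2 : E)] (h : IsStandardBasis b e)
    (B : Module.End E (ExteriorAlgebra E (W₁ e)))
    (hB : ∀ v x, B (vectorAction b e v x) = vectorAction b e v (B x)) : ∃ c : E, ∀ x, B x = c • x := by
  obtain ⟨c, hc⟩ := exists_algebraMap_of_vacuum h (x := B 1) fun i => by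
    rw [← hB, vectorAction_inr_one, map_zero]
  refine ⟨c, LinearMap.congr_fun (linearMap_ext_of_vectorAction h (F := B) (F' := c • LinearMap.id)
    (fun v x => vectorAction b e v x) ?_ hB fun v x => ?_)⟩
  · rw [hc, Algebra.algebraMap_eq_smul_one]
    rfl
  · exact (map_smul (vectorAction b e v) c x).symm

/-- The ideal generated by the product of the `e_{n+i}` is the whole Clifford algebra. -/
theorem one_mem_of_prod_mem [NeZero (2 : E)] (h : IsStandardBasis b e)
    (I : TwoSidedIdeal (CliffordAlgebra (quad b))) (l : List (Fin n))
    (hl : l.Nodup) (hI : (l.map fun i => CliffordAlgebra.ι (quad b) (e (.inr i))).prod ∈ I) :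
    (1 : CliffordAlgebra (quad b)) ∈ I := by
  let c := CliffordAlgebra.ι (quad b)
  -- Here `s` is the sign picked up when `e_i` passes the product.
  have hc : ∀ i (l : List (Fin n)), i ∉ l → ∃ s : CliffordAlgebra (quad b),
      (l.map fun i => c (e (.inr i))).prod * c (e (.inl i)) * s =
        c (e (.inl i)) * (l.map fun i => c (e (.inr i))).prod := by
    intro i l
    induction l with
    | nil => exact fun _ => ⟨1, by simp⟩
    | cons j l ih =>
      intro hj
      obtain ⟨s, hs⟩ := ih fun h => hj (List.mem_cons_of_mem _ h)
      have hij : i ≠ j := fun h => hj (h ▸ List.mem_cons_self)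
      have := h.ι_anticomm (e (.inr j)) (e (.inl i))
      rw [h.apply_basis_left, Sum.swap_inr, Module.Basis.repr_self,
        Finsupp.single_eq_of_ne (by simpa using hij.symm), map_zero] at this
      refine ⟨-s, ?_⟩
      rw [List.map_cons, List.prod_cons, ← mul_assoc (c (e (.inl i))),
        eq_neg_of_add_eq_zero_right this, mul_neg, mul_assoc, mul_assoc, ← mul_assoc _ _ s, hs,
        neg_mul, mul_assoc]
  induction l with
  | nil => simpa using hI
  | cons i l ih =>
    refine ih hl.of_cons ?_
    obtain ⟨s, hs⟩ := hc i l (List.nodup_cons.1 hl).1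
    have h1 := h.ι_anticomm (e (.inl i)) (e (.inr i))
    rw [h.apply_basis_left, Sum.swap_inl, Module.Basis.repr_self, Finsupp.single_eq_same,
      map_one] at h1
    -- Since `e_i e_{n+i} + e_{n+i} e_i = 1`, multiplying by `e_i` on both sides strips one factor
    -- off the product.
    have h2 : (l.map fun i => c (e (.inr i))).prod =
        c (e (.inl i)) * ((i :: l).map fun i => c (e (.inr i))).prod +
          ((i :: l).map fun i => c (e (.inr i))).prod * c (e (.inl i)) * s := by
      rw [List.map_cons, List.prod_cons, mul_assoc, mul_assoc, ← mul_assoc _ _ s, hs,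
        ← mul_assoc, ← mul_assoc, ← add_mul, h1, one_mul]
    have h3 := I.add_mem (I.mul_mem_left (c (e (.inl i))) _ hI)
      (I.mul_mem_right _ s (I.mul_mem_right _ (c (e (.inl i))) hI))
    rw [← h2] at h3
    exact h3

/-- The spin module is faithful. -/
theorem spinAction_injective [NeZero (2 : E)] (h : IsStandardBasis b e) :
    Function.Injective (spinAction h) := by
  rw [injective_iff_map_eq_zero]
  intro z hz
  let c := CliffordAlgebra.ι (quad b)
  -- `Ω` is killed on the left by every `e_{n+i}`, so each `Ω * y` is a vacuum for left
  -- multiplication, and the spin module maps onto the left ideal it generates.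
  let Ω := ((List.finRange n).map fun i => c (e (.inr i))).prod
  have hΩ : ∀ i, c (e (.inr i)) * Ω = 0 := by
    intro i
    have : ∀ l : List (Fin n), i ∈ l →
        c (e (.inr i)) * (l.map fun i => c (e (.inr i))).prod = 0 := by
      intro l
      induction l with
      | nil => exact fun h => absurd h List.not_mem_nil
      | cons j l ih =>
        intro hj
        rw [List.map_cons, List.prod_cons, ← mul_assoc]
        by_cases hij : i = j
        · subst hij
          rw [CliffordAlgebra.ι_sq_scalar, IsStandardBasis.quad_eq, h.apply_basis_left]
          simp
        · have h1 := h.ι_anticomm (e (.inr i)) (e (.inr j))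
          rw [h.apply_basis_left, Sum.swap_inr, Module.Basis.repr_self,
            Finsupp.single_eq_of_ne (by simp), map_zero] at h1
          rw [eq_neg_of_add_eq_zero_left h1, neg_mul, mul_assoc,
            ih ((List.mem_cons.1 hj).resolve_left hij), mul_zero, neg_zero]
    exact this _ (List.mem_finRange i)
  have hann : ∀ x y, spinAction h x = 0 → x * Ω * y = 0 := by
    intro x y hx
    obtain ⟨F, hF1, hF⟩ := exists_linear_of_vacuum h
      ((LinearMap.mul E (CliffordAlgebra (quad b))) ∘ₗ c)
      (fun v => LinearMap.ext fun x => by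
        change c v * (c v * x) = _
        rw [← mul_assoc, CliffordAlgebra.ι_sq_scalar, Module.algebraMap_end_apply,
          Algebra.smul_def]) (Ω * y) (fun i => by
        change c (e (.inr i)) * (Ω * y) = 0
        rw [← mul_assoc, hΩ, zero_mul])
    have : ∀ x s, F (spinAction h x s) = x * F s := by
      intro x
      induction x using CliffordAlgebra.induction with
      | algebraMap r =>
        intro s
        rw [AlgHom.commutes, Module.algebraMap_end_apply, map_smul, Algebra.smul_def]
      | ι v =>
        intro s
        rw [spinAction_ι, hF]
        rfl
      | mul x y hx hy =>
        intro s
        rw [map_mul, Module.End.mul_apply, hx, hy, mul_assoc]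
      | add x y hx hy =>
        intro s
        rw [map_add, LinearMap.add_apply, map_add, hx, hy, add_mul]
    rw [mul_assoc, ← hF1, ← this, hx, LinearMap.zero_apply, map_zero]
  -- The elements `u` annihilated in this way by the kernel form a two-sided ideal. It contains `Ω`,
  -- hence `1`, so the kernel is zero.
  let I : TwoSidedIdeal (CliffordAlgebra (quad b)) := TwoSidedIdeal.mk'
    {u | ∀ x y, spinAction h x = 0 → x * u * y = 0} (fun x y _ => by simp)
    (fun {u u'} hu hu' x y hx => by rw [mul_add, add_mul, hu x y hx, hu' x y hx, add_zero])
    (fun {u} hu x y hx => by rw [mul_neg, neg_mul, hu x y hx, neg_zero])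
    (fun {r u} hu x y hx => by
      rw [← mul_assoc]
      exact hu _ _ (by rw [map_mul, hx, zero_mul]))
    (fun {u r} hu x y hx => by
      rw [← mul_assoc, mul_assoc _ r]
      exact hu _ _ hx)
  have h1 := one_mem_of_prod_mem h I (List.finRange n) (List.nodup_finRange n)
    ((TwoSidedIdeal.mem_mk' ..).2 hann)
  simpa using (TwoSidedIdeal.mem_mk' ..).1 h1 z 1 hz

instance : Module.Finite E (W₁ e) :=
  Module.Finite.span_of_finite E (Set.finite_range _)

/-- The exterior powers are finite-dimensional and vanish above the rank. -/
theorem finite_exteriorAlgebra (K M : Type*) [Field K] [AddCommGroup M] [Module K M]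
    [Module.Finite K M] : Module.Finite K (ExteriorAlgebra K M) := by
  have htop : (⨆ i : Fin (Module.finrank K M + 1), ⋀[K]^(i : ℕ) M) = ⊤ := by
    rw [eq_top_iff, ← CliffordAlgebra.iSup_ι_range_eq_top (0 : QuadraticForm K M)]
    refine iSup_le fun i => ?_
    by_cases hi : i < Module.finrank K M + 1
    · exact le_iSup (fun i : Fin (Module.finrank K M + 1) => ⋀[K]^(i : ℕ) M) ⟨i, hi⟩
    · have : ⋀[K]^i M = ⊥ := by
        rw [← Submodule.finrank_eq_zero (R := K), exteriorPower.finrank_eq,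
          Nat.choose_eq_zero_of_lt (by omega)]
      exact this.le.trans bot_le
  rw [Module.finite_def, ← htop]
  exact Submodule.fg_iSup _ fun i => Module.Finite.iff_fg.1 (exteriorPower.instFinite ..)

instance : Module.Finite E (ExteriorAlgebra E (W₁ e)) :=
  finite_exteriorAlgebra E (W₁ e)

end Fock

/-! ### Operators that are scalar on the even and on the odd part -/

section Parity

variable {E W : Type*} [Field E] [AddCommGroup W] [Module E W] {n : ℕ}
  {b : LinearMap.BilinForm E W} {e : Module.Basis (Fin n ⊕ Fin n) E W}

theorem exists_even_add_odd (x : ExteriorAlgebra E (W₁ e)) :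
    ∃ y ∈ S e 0, ∃ z ∈ S e 1, y + z = x :=
  Submodule.mem_sup.1 ((CliffordAlgebra.evenOdd_isCompl
    (0 : QuadraticForm E (W₁ e))).sup_eq_top ▸ Submodule.mem_top)

theorem vectorAction_mem_odd (v : W) {x : ExteriorAlgebra E (W₁ e)} (hx : x ∈ S e 0) :
    vectorAction b e v x ∈ S e 1 := by
  simpa using vectorAction_mem b e v hx

theorem vectorAction_mem_even (v : W) {x : ExteriorAlgebra E (W₁ e)} (hx : x ∈ S e 1) :
    vectorAction b e v x ∈ S e 0 :=
  by simpa using (show (1 : ZMod 2) + 1 = 0 from rfl) ▸ vectorAction_mem b e v hx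

theorem one_mem_even : (1 : ExteriorAlgebra E (W₁ e)) ∈ S e 0 :=
  Submodule.one_le.1 (CliffordAlgebra.one_le_evenOdd_zero (0 : QuadraticForm E (W₁ e)))

variable (e) in
/-- The operator on the spin module that is multiplication by `c` on the even part and
multiplication by `d` on the odd part. -/
def parityScale [NeZero (2 : E)] (c d : E) : Module.End E (ExteriorAlgebra E (W₁ e)) :=
  (2⁻¹ * (c + d)) • LinearMap.id +
    (2⁻¹ * (c - d)) • (CliffordAlgebra.involute (Q := (0 : QuadraticForm E (W₁ e)))).toLinearMap

variable [NeZero (2 : E)]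

theorem parityScale_even (c d : E) {x : ExteriorAlgebra E (W₁ e)} (hx : x ∈ S e 0) :
    parityScale e c d x = c • x := by
  have h2 : (2 : E) ≠ 0 := NeZero.ne 2
  have : parityScale e c d x = (2⁻¹ * (c + d)) • x + (2⁻¹ * (c - d)) •
      CliffordAlgebra.involute (Q := (0 : QuadraticForm E (W₁ e))) x := rfl
  rw [this, CliffordAlgebra.involute_eq_of_mem_even hx, ← add_smul]
  congr 1
  field_simp
  ring

theorem parityScale_odd (c d : E) {x : ExteriorAlgebra E (W₁ e)} (hx : x ∈ S e 1) :
    parityScale e c d x = d • x := by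
  have h2 : (2 : E) ≠ 0 := NeZero.ne 2
  have : parityScale e c d x = (2⁻¹ * (c + d)) • x + (2⁻¹ * (c - d)) •
      CliffordAlgebra.involute (Q := (0 : QuadraticForm E (W₁ e))) x := rfl
  rw [this, CliffordAlgebra.involute_eq_of_mem_odd hx, smul_neg, ← sub_eq_add_neg, ← sub_smul]
  congr 1
  field_simp
  ring

theorem parityScale_add (c d : E) {x y : ExteriorAlgebra E (W₁ e)} (hx : x ∈ S e 0)
    (hy : y ∈ S e 1) : parityScale e c d (x + y) = c • x + d • y := by
  rw [map_add, parityScale_even c d hx, parityScale_odd c d hy]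

theorem parityScale_vectorAction (c d : E) (v : W) (x : ExteriorAlgebra E (W₁ e)) :
    parityScale e c d (vectorAction b e v x) = vectorAction b e v (parityScale e d c x) := by
  obtain ⟨y, hy, z, hz, rfl⟩ := exists_even_add_odd x
  rw [parityScale_add d c hy hz, map_add, map_add, map_add, map_smul, map_smul,
    parityScale_odd c d (vectorAction_mem_odd v hy),
    parityScale_even c d (vectorAction_mem_even v hz)]

theorem mem_even_of_parityScale {x : ExteriorAlgebra E (W₁ e)} (hx : parityScale e 1 0 x = x) :
    x ∈ S e 0 := by
  obtain ⟨y, hy, z, hz, rfl⟩ := exists_even_add_odd x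
  rw [parityScale_add 1 0 hy hz, one_smul, zero_smul, add_zero] at hx
  rwa [← hx]

theorem mem_odd_of_parityScale {x : ExteriorAlgebra E (W₁ e)} (hx : parityScale e 0 1 x = x) :
    x ∈ S e 1 := by
  obtain ⟨y, hy, z, hz, rfl⟩ := exists_even_add_odd x
  rw [parityScale_add 0 1 hy hz, one_smul, zero_smul, zero_add] at hx
  rwa [← hx]

theorem parityScale_comm (c d c' d' : E) (x : ExteriorAlgebra E (W₁ e)) :
    parityScale e c d (parityScale e c' d' x) = parityScale e c' d' (parityScale e c d x) := by
  obtain ⟨y, hy, z, hz, rfl⟩ := exists_even_add_odd x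
  rw [parityScale_add c' d' hy hz, parityScale_add c d hy hz,
    parityScale_add c d (Submodule.smul_mem _ _ hy) (Submodule.smul_mem _ _ hz),
    parityScale_add c' d' (Submodule.smul_mem _ _ hy) (Submodule.smul_mem _ _ hz)]
  simp only [smul_smul, mul_comm]

end Parity

/-! ### Exterior monomials and their contractions -/

section TopForm

variable {E W : Type*} [Field E] [AddCommGroup W] [Module E W] {n : ℕ}
  {b : LinearMap.BilinForm E W} {e : Module.Basis (Fin n ⊕ Fin n) E W}

variable (b e) in
/-- The exterior product of the `e_i` for `i` in a list. -/
def wedge (l : List (Fin n)) : ExteriorAlgebra E (W₁ e) :=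
  (l.map fun i => vectorAction b e (e (.inl i))).prod 1

variable (b e) in
theorem wedge_cons (i : Fin n) (l : List (Fin n)) :
    wedge b e (i :: l) = vectorAction b e (e (.inl i)) (wedge b e l) := by
  rw [wedge, List.map_cons, List.prod_cons]
  rfl

variable (b e) in
theorem wedge_mem (l : List (Fin n)) : wedge b e l ∈ S e (l.length : ZMod 2) := by
  induction l with
  | nil => simpa [wedge] using one_mem_even (e := e)
  | cons i l ih =>
    rw [wedge_cons, List.length_cons, Nat.cast_succ, add_comm]
    exact vectorAction_mem b e _ ih

theorem vectorAction_wedge [NeZero (2 : E)] (h : IsStandardBasis b e) {i : Fin n} {l : List (Fin n)}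
    (hi : i ∈ l) : vectorAction b e (e (.inl i)) (wedge b e l) = 0 := by
  induction l with
  | nil => exact absurd hi List.not_mem_nil
  | cons j l ih =>
    rw [wedge_cons]
    by_cases hij : i = j
    · subst hij
      have := LinearMap.congr_fun (vectorAction_sq h (e (.inl i))) (wedge b e l)
      rw [Module.End.mul_apply, IsStandardBasis.quad_eq, h.apply_basis_left] at this
      rw [this]
      simp
    · have := vectorAction_anticomm h (e (.inl i)) (e (.inl j)) (wedge b e l)
      rw [ih ((List.mem_cons.1 hi).resolve_left hij), map_zero, add_zero,
        h.apply_basis_left] at this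
      rw [this]
      simp

theorem contract_vectorAction [NeZero (2 : E)] (h : IsStandardBasis b e) {i : Fin n} {l : List (Fin n)}
    (hi : i ∉ l) (x : ExteriorAlgebra E (W₁ e)) :
    (l.map fun i => vectorAction b e (e (.inr i))).prod (vectorAction b e (e (.inl i)) x) =
      (-1 : E) ^ l.length • vectorAction b e (e (.inl i))
        ((l.map fun i => vectorAction b e (e (.inr i))).prod x) := by
  induction l with
  | nil => simp
  | cons j l ih =>
    have hij : j ≠ i := fun h => hi (h ▸ List.mem_cons_self)
    have := vectorAction_anticomm h (e (.inr j)) (e (.inl i))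
      ((l.map fun i => vectorAction b e (e (.inr i))).prod x)
    rw [h.apply_basis_left, Sum.swap_inr, Module.Basis.repr_self,
      Finsupp.single_eq_of_ne (by simpa using hij), zero_smul] at this
    rw [List.map_cons, List.prod_cons, Module.End.mul_apply, Module.End.mul_apply,
      ih fun h => hi (List.mem_cons_of_mem _ h), map_smul, eq_neg_of_add_eq_zero_left this,
      List.length_cons, pow_succ, mul_neg_one, neg_smul, smul_neg]

/-- The contractions are applied in the same order as the factors of the wedge. The `k`-th from the
end passes `k - 1` factors, and these signs add up to the binomial coefficient. -/
theorem contract_wedge [NeZero (2 : E)] (h : IsStandardBasis b e) {l : List (Fin n)} (hl : l.Nodup) :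
    (l.map fun i => vectorAction b e (e (.inr i))).prod (wedge b e l) =
      (-1 : E) ^ (l.length.choose 2) • 1 := by
  induction l with
  | nil => simp [wedge]
  | cons i l ih =>
    have := vectorAction_anticomm h (e (.inr i)) (e (.inl i)) 1
    rw [vectorAction_inr_one, map_zero, add_zero, h.apply_basis_left, Sum.swap_inr,
      Module.Basis.repr_self, Finsupp.single_eq_same, one_smul] at this
    rw [List.map_cons, List.prod_cons, Module.End.mul_apply, wedge_cons,
      contract_vectorAction h (List.nodup_cons.1 hl).1, ih hl.of_cons, map_smul, map_smul,
      map_smul, this, smul_smul, ← pow_add, List.length_cons, Nat.choose_succ_succ _ 1,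
      Nat.choose_one_right]

end TopForm

/-! ### The semilinear map `J` on `W` and its lift `F` to the spin module -/

section Semilinear

variable {E₀ E W : Type*} [Field E₀] [Field E] [Algebra E₀ E] [AddCommGroup W] [Module E W]
  {σ : E ≃ₐ[E₀] E} {n : ℕ}

/-- The semilinear map `J` with `ψ(z, w) = b(z, J w)`: it sends `e_i` to `a_i e_{n+i}` and
`e_{n+i}` to `a_{n+i} e_i`. -/
def conjJ (σ : E ≃ₐ[E₀] E) (e : Module.Basis (Fin n ⊕ Fin n) E W) (a : Fin n ⊕ Fin n → E₀) :
    W →ₛₗ[(σ : E →+* E)] W where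
  toFun w := ∑ r, (algebraMap E₀ E (a r) * σ (e.repr w r)) • e r.swap
  map_add' v w := by simp [mul_add, add_smul, Finset.sum_add_distrib]
  map_smul' c w := by simp [Finset.smul_sum, smul_smul, mul_left_comm]

variable {e : Module.Basis (Fin n ⊕ Fin n) E W} {a : Fin n ⊕ Fin n → E₀}

theorem conjJ_basis (r : Fin n ⊕ Fin n) :
    conjJ σ e a (e r) = algebraMap E₀ E (a r) • e r.swap := by
  change ∑ s, (algebraMap E₀ E (a s) * σ (e.repr (e r) s)) • e s.swap = _
  rw [Finset.sum_eq_single r]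
  · simp
  · intro s _ hs
    simp [Finsupp.single_eq_of_ne hs]
  · simp

theorem repr_conjJ (w : W) (r : Fin n ⊕ Fin n) :
    e.repr (conjJ σ e a w) r = algebraMap E₀ E (a r.swap) * σ (e.repr w r.swap) := by
  change e.repr (∑ s, (algebraMap E₀ E (a s) * σ (e.repr w s)) • e s.swap) r = _
  rw [map_sum, Finsupp.finsetSum_apply, Finset.sum_eq_single r.swap]
  · simp
  · intro s _ hs
    have : s.swap ≠ r := fun h => hs (h ▸ (Sum.swap_swap s).symm)
    simp [Finsupp.single_eq_of_ne this.symm]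
  · simp

namespace IsGoodBasis

variable {b : LinearMap.BilinForm E W} {ψ : W →ₗ[E] W →ₛₗ[(σ : E →+* E)] E} {lam : E₀}

theorem ψ_eq (he : IsGoodBasis b ψ e a lam) (z w : W) : ψ z w = b z (conjJ σ e a w) := by
  rw [he.diagonal, he.standard, Fintype.sum_sum_type, ← Finset.sum_add_distrib]
  refine Finset.sum_congr rfl fun i _ => ?_
  rw [repr_conjJ, repr_conjJ, Sum.swap_inl, Sum.swap_inr]
  ring

theorem mul_swap (he : IsGoodBasis b ψ e a lam) (r : Fin n ⊕ Fin n) : a r * a r.swap = lam := by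
  cases r with
  | inl i => exact he.mul_eq i
  | inr i => rw [mul_comm]; exact he.mul_eq i

theorem conjJ_conjJ (he : IsGoodBasis b ψ e a lam) (hσ : ∀ x, σ (σ x) = x) (w : W) :
    conjJ σ e a (conjJ σ e a w) = algebraMap E₀ E lam • w := by
  refine e.ext_elem fun r => ?_
  rw [repr_conjJ, repr_conjJ, map_mul, hσ, AlgEquiv.commutes, Sum.swap_swap, map_smul,
    Finsupp.smul_apply, ← he.mul_swap r, smul_eq_mul, map_mul]
  ring

/-- `J` exchanges the coordinates `i` and `n+i`, and each term acquires the factor `aᵢ a_{n+i} = λ`.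
-/
theorem b_conjJ (he : IsGoodBasis b ψ e a lam) (v w : W) :
    b (conjJ σ e a v) (conjJ σ e a w) = algebraMap E₀ E lam * σ (b v w) := by
  rw [he.standard, he.standard, map_sum, Finset.mul_sum]
  refine Finset.sum_congr rfl fun i => ?_
  simp only [repr_conjJ, Sum.swap_inl, Sum.swap_inr, map_add, map_mul, ← he.mul_eq i]
  intro _
  ring

theorem quad_conjJ [NeZero (2 : E)] (he : IsGoodBasis b ψ e a lam) (v : W) :
    quad b (conjJ σ e a v) = algebraMap E₀ E lam * σ (quad b v) := by
  rw [IsStandardBasis.quad_eq, he.b_conjJ, IsStandardBasis.quad_eq, map_mul, map_inv₀, map_ofNat]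
  ring

end IsGoodBasis

/-- The scalar by which the square of the semilinear operator acts on the two half spin modules. -/
def spinScalar (m : ℕ) (D lam : E₀) (ε : ZMod 2) : E₀ :=
  (-1) ^ m * D * (lam⁻¹) ^ m * if ε = 0 then 1 else lam

theorem spinScalar_zero (m : ℕ) (D lam : E₀) :
    spinScalar m D lam 0 = (-1) ^ m * D * lam⁻¹ ^ m := by
  rw [spinScalar, if_pos rfl, mul_one]

theorem spinScalar_one (m : ℕ) (D lam : E₀) :
    spinScalar m D lam 1 = (-1) ^ m * D * lam⁻¹ ^ m * lam := by
  rw [spinScalar, if_neg one_ne_zero]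

variable {b : LinearMap.BilinForm E W} {ψ : W →ₗ[E] W →ₛₗ[(σ : E →+* E)] E} {lam : E₀}

/-- A semilinear operator on the spin module that is compatible with `J`. -/
structure IsSpinJ {m : ℕ} (b : LinearMap.BilinForm E W)
    (e : Module.Basis (Fin (2 * m) ⊕ Fin (2 * m)) E W) (a : Fin (2 * m) ⊕ Fin (2 * m) → E₀)
    (lam : E₀) (F : ExteriorAlgebra E (W₁ e) →ₛₗ[(σ : E →+* E)] ExteriorAlgebra E (W₁ e)) :
    Prop where
  mem : ∀ ε, ∀ x ∈ S e ε, F x ∈ S e ε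
  even : ∀ v, ∀ x ∈ S e 0, F (vectorAction b e v x) = vectorAction b e (conjJ σ e a v) (F x)
  odd : ∀ v, ∀ x ∈ S e 1, F (vectorAction b e v x) =
    (algebraMap E₀ E lam)⁻¹ • vectorAction b e (conjJ σ e a v) (F x)
  sq : ∀ ε, ∀ x ∈ S e ε, F (F x) = algebraMap E₀ E (spinScalar m (∏ i, a (.inl i)) lam ε) • x

/-- The lift comes from the universal property of the spin module with the top form as image of `1`.
Its square is then determined by its value at `1`. -/
theorem exists_spinJ [NeZero (2 : E)] {m : ℕ} {e : Module.Basis (Fin (2 * m) ⊕ Fin (2 * m)) E W}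
    {a : Fin (2 * m) ⊕ Fin (2 * m) → E₀} (he : IsGoodBasis b ψ e a lam) (hlam : lam ≠ 0)
    (hσ : ∀ x, σ (σ x) = x) :
    ∃ F : ExteriorAlgebra E (W₁ e) →ₛₗ[(σ : E →+* E)] ExteriorAlgebra E (W₁ e),
      IsSpinJ b e a lam F := by
  set J := conjJ σ e a with hJ
  set l := algebraMap E₀ E lam with hl
  have hl0 : l ≠ 0 := by simpa [hl] using hlam
  have hσl : σ l = l := AlgEquiv.commutes σ lam
  set top := wedge b e (List.finRange (2 * m)) with htop
  have htop0 : top ∈ S e 0 := by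
    have := wedge_mem b e (List.finRange (2 * m))
    have h2 : ((2 * m : ℕ) : ZMod 2) = 0 := (ZMod.natCast_eq_zero_iff _ _).2 ⟨m, rfl⟩
    rwa [List.length_finRange, h2] at this
  -- `J(v)` squares to `λ σ(quad v)`. As vectors change parity, inserting `Θ` contributes exactly
  -- one `λ⁻¹` to the product of two factors, which restores the Clifford relation without a square
  -- root of `λ`.
  let Θ := parityScale e 1 l⁻¹
  let G : W →ₛₗ[(σ : E →+* E)] Module.End E (ExteriorAlgebra E (W₁ e)) :=
    (LinearMap.mulRight E Θ ∘ₗ vectorAction b e).comp J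
  have hGdef : ∀ v x, G v x = vectorAction b e (J v) (Θ x) := fun _ _ => rfl
  have hG : ∀ v, G v * G v = algebraMap E _ ((σ : E →+* E) (quad b v)) := by
    intro v
    refine LinearMap.ext fun x => ?_
    have hsq := fun x => LinearMap.congr_fun (vectorAction_sq he.standard (J v)) x
    simp only [Module.End.mul_apply, Module.algebraMap_end_apply] at hsq
    rw [Module.End.mul_apply, hGdef, hGdef, parityScale_vectorAction, hsq, he.quad_conjJ]
    obtain ⟨y, hy, z, hz, rfl⟩ := exists_even_add_odd x
    rw [parityScale_add _ _ hy hz, parityScale_add _ _ (Submodule.smul_mem _ _ hy)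
      (Submodule.smul_mem _ _ hz), one_smul, one_smul, ← smul_add, smul_smul,
      Module.algebraMap_end_apply]
    congr 1
    change l * _ * _ = _
    field_simp
    rfl
  -- `J(e_{n+i})` is a multiple of `e_i`, which kills the top form.
  obtain ⟨F, hF1, hF⟩ := exists_semilinear_of_vacuum he.standard (σ : E →+* E) G hG top fun i => by
    rw [hGdef, parityScale_even _ _ htop0, one_smul, hJ, conjJ_basis, map_smul,
      LinearMap.smul_apply, Sum.swap_inr,
      vectorAction_wedge he.standard (List.mem_finRange i), smul_zero]
  -- `F` respects parity because the top form is even. This is phrased with `parityScale` so that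
  -- the induction applies to arbitrary `x`.
  have hpar : ∀ x c d, F (parityScale e c d x) = parityScale e (σ c) (σ d) (F x) := by
    intro x
    induction x using spinor_induction he.standard with
    | algebraMap r =>
      intro c d
      have h1 : algebraMap E (ExteriorAlgebra E (W₁ e)) r ∈ S e 0 := by
        rw [Algebra.algebraMap_eq_smul_one]
        exact Submodule.smul_mem _ _ one_mem_even
      have h2 : F (algebraMap E _ r) ∈ S e 0 := by
        rw [Algebra.algebraMap_eq_smul_one, map_smulₛₗ, hF1]
        exact Submodule.smul_mem _ _ htop0
      rw [parityScale_even _ _ h1, parityScale_even _ _ h2, map_smulₛₗ]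
      rfl
    | add x y hx hy =>
      intro c d
      rw [map_add, map_add, map_add, map_add, hx, hy]
    | vector v x hx =>
      intro c d
      rw [parityScale_vectorAction, hF, hF, hGdef, hGdef, hx, parityScale_comm,
        parityScale_vectorAction]
  have hmem : ∀ ε, ∀ x ∈ S e ε, F x ∈ S e ε := by
    intro ε x hx
    fin_cases ε
    · refine mem_even_of_parityScale ?_
      have := hpar x 1 0
      rwa [parityScale_even _ _ hx, one_smul, map_one, map_zero, eq_comm] at this
    · refine mem_odd_of_parityScale ?_
      have := hpar x 0 1
      rwa [parityScale_odd _ _ hx, one_smul, map_one, map_zero, eq_comm] at this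
  have heven : ∀ v, ∀ x ∈ S e 0, F (vectorAction b e v x) = vectorAction b e (J v) (F x) := by
    intro v x hx
    rw [hF, hGdef, parityScale_even _ _ (hmem 0 x hx), one_smul]
  have hodd : ∀ v, ∀ x ∈ S e 1, F (vectorAction b e v x) =
      l⁻¹ • vectorAction b e (J v) (F x) := by
    intro v x hx
    rw [hF, hGdef, parityScale_odd _ _ (hmem 1 x hx), map_smul]
  -- A factor `λ⁻¹` appears each time a vector is applied to an odd element, which happens `⌊|L| /
  -- 2⌋` times while the wedge is built up.
  have hwedge : ∀ L : List (Fin (2 * m)), F (wedge b e L) =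
      ((L.map fun i => algebraMap E₀ E (a (.inl i))).prod * l⁻¹ ^ (L.length / 2)) •
        (L.map fun i => vectorAction b e (e (.inr i))).prod top := by
    intro L
    induction L with
    | nil => simp [wedge, hF1]
    | cons i L ih =>
      have hi : J (e (.inl i)) = algebraMap E₀ E (a (.inl i)) • e (.inr i) := conjJ_basis _
      have hL := wedge_mem b e L
      rw [wedge_cons, List.map_cons, List.map_cons, List.prod_cons, List.prod_cons,
        List.length_cons, Module.End.mul_apply]
      rcases Nat.even_or_odd' L.length with ⟨k, hk | hk⟩
      · have h2 : ((2 * k : ℕ) : ZMod 2) = 0 := (ZMod.natCast_eq_zero_iff _ _).2 ⟨k, rfl⟩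
        rw [hk, h2] at hL
        rw [heven _ _ hL, ih, hk, (vectorAction b e (J _)).map_smul, hi,
          (vectorAction b e).map_smul, LinearMap.smul_apply, smul_smul,
          show (2 * k + 1) / 2 = k by omega, show 2 * k / 2 = k by omega]
        congr 1
        ring
      · have h2 : ((2 * k + 1 : ℕ) : ZMod 2) = 1 := by
          rw [Nat.cast_succ, (ZMod.natCast_eq_zero_iff _ _).2 ⟨k, rfl⟩, zero_add]
        rw [hk, h2] at hL
        rw [hodd _ _ hL, ih, hk, (vectorAction b e (J _)).map_smul, hi,
          (vectorAction b e).map_smul, LinearMap.smul_apply, smul_smul,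
          smul_smul, show (2 * k + 1 + 1) / 2 = k + 1 by omega,
          show (2 * k + 1) / 2 = k by omega]
        congr 1
        ring
  set c := algebraMap E₀ E ((-1) ^ m * (∏ i, a (.inl i)) * lam⁻¹ ^ m) with hc
  -- The sign is `(-1)^(m(2m-1)) = (-1)^m`.
  have hFtop : F top = c • 1 := by
    rw [htop, hwedge, htop, contract_wedge he.standard (List.nodup_finRange _), smul_smul,
      List.length_finRange, Nat.choose_two_right]
    congr 1
    have h1 : 2 * m * (2 * m - 1) / 2 = m * (2 * m - 1) := by
      rw [mul_assoc, Nat.mul_div_cancel_left _ two_pos]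
    have h2 : (-1 : E) ^ (m * (2 * m - 1)) = (-1) ^ m := by
      rcases Nat.eq_zero_or_pos m with rfl | hm
      · simp
      · rw [mul_comm, pow_mul, Odd.neg_one_pow ⟨m - 1, by omega⟩]
    rw [h1, h2, Nat.mul_div_cancel_left _ two_pos, hc]
    simp only [map_mul, map_pow, map_neg, map_one, map_prod, map_inv₀, List.prod_ofFn,
      ← List.ofFn_eq_map]
    ring
  let FF : Module.End E (ExteriorAlgebra E (W₁ e)) :=
    { toFun x := F (F x)
      map_add' x y := by rw [map_add, map_add]
      map_smul' r x := by
        rw [map_smulₛₗ, map_smulₛₗ]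
        exact congrArg (· • _) (hσ r) }
  -- Both sides send `1` to `c` and satisfy the same recursion: `J² = λ` contributes `λ`, and on an
  -- odd argument the two applications of `F` contribute a further `λ⁻²`.
  have hFF : FF = parityScale e c (l * c) := by
    refine linearMap_ext_of_vectorAction he.standard
      (fun v x => l • vectorAction b e v (parityScale e 1 (l⁻¹ * l⁻¹) x)) ?_ ?_ ?_
    · rw [parityScale_even _ _ one_mem_even, ← hFtop, ← hF1]
      rfl
    · intro v x
      obtain ⟨y, hy, z, hz, rfl⟩ := exists_even_add_odd x
      change F (F _) = l • vectorAction b e v (parityScale e 1 _ (F (F _)))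
      have hy' := hmem 0 y hy
      have hz' := hmem 1 z hz
      simp only [map_add]
      rw [heven v y hy, hodd v z hz, heven _ _ hy', map_smulₛₗ, hodd _ _ hz',
        parityScale_even _ _ (hmem 0 _ hy'), parityScale_odd _ _ (hmem 1 _ hz'),
        he.conjJ_conjJ hσ]
      simp only [map_smul, LinearMap.smul_apply, smul_add, smul_smul, one_smul]
      congr 2
      change σ l⁻¹ * _ = _
      rw [map_inv₀, hσl]
      ring
    · intro v x
      obtain ⟨y, hy, z, hz, rfl⟩ := exists_even_add_odd x
      rw [parityScale_vectorAction, parityScale_add _ _ hy hz, parityScale_add _ _ hy hz,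
        parityScale_add _ _ (Submodule.smul_mem _ _ hy) (Submodule.smul_mem _ _ hz), ← map_smul]
      congr 1
      simp only [smul_add, smul_smul]
      congr 2
      · ring
      · field_simp
  refine ⟨F, hmem, heven, hodd, fun ε x hx => ?_⟩
  change FF x = _
  rw [hFF]
  fin_cases ε
  · rw [parityScale_even _ _ hx]
    change _ = algebraMap E₀ E (spinScalar m _ lam 0) • x
    rw [spinScalar_zero]
  · rw [parityScale_odd _ _ hx]
    change _ = algebraMap E₀ E (spinScalar m _ lam 1) • x
    rw [spinScalar_one, map_mul, mul_comm l]

end Semilinear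

/-! ### The group `G₁` commutes with `F` -/

section Commutation

variable {E₀ E W : Type*} [Field E₀] [Field E] [Algebra E₀ E] [AddCommGroup W] [Module E W]
  [NeZero (2 : E)] {σ : E ≃ₐ[E₀] E} {m : ℕ} {b : LinearMap.BilinForm E W}
  {ψ : W →ₗ[E] W →ₛₗ[(σ : E →+* E)] E} {lam : E₀}
  {e : Module.Basis (Fin (2 * m) ⊕ Fin (2 * m)) E W} {a : Fin (2 * m) ⊕ Fin (2 * m) → E₀}

omit [NeZero (2 : E)] in
theorem IsGoodBasis.spinScalar_ne_zero {n : ℕ} {e : Module.Basis (Fin n ⊕ Fin n) E W}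
    {a : Fin n ⊕ Fin n → E₀} (he : IsGoodBasis b ψ e a lam) (hlam : lam ≠ 0)
    (m : ℕ) (ε : ZMod 2) : spinScalar m (∏ i, a (.inl i)) lam ε ≠ 0 := by
  have h1 : (∏ i, a (.inl i)) ≠ 0 := Finset.prod_ne_zero_iff.2 fun i _ hi =>
    hlam (by rw [← he.mul_eq i, hi, zero_mul])
  have h2 : (if ε = 0 then 1 else lam) ≠ 0 := by split_ifs <;> simp [hlam]
  exact mul_ne_zero (mul_ne_zero (mul_ne_zero (pow_ne_zero _ (neg_ne_zero.2 one_ne_zero)) h1)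
    (pow_ne_zero _ (inv_ne_zero hlam))) h2

-- `b(Tu, T J w) = b(u, J w) = ψ(u, w) = ψ(Tu, Tw) = b(Tu, J T w)`, and `b` is nondegenerate.
omit [NeZero (2 : E)] in
theorem IsGoodBasis.conjJ_comm (he : IsGoodBasis b ψ e a lam) {T : W ≃ₗ[E] W}
    (hT : T ∈ G₀ b ψ) (w : W) : T (conjJ σ e a w) = conjJ σ e a (T w) := by
  rw [← sub_eq_zero]
  refine he.standard.eq_zero fun v => ?_
  obtain ⟨u, rfl⟩ := T.surjective v
  rw [map_sub, sub_eq_zero, hT.2.1, ← he.ψ_eq, ← he.ψ_eq, hT.2.2]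

namespace IsSpinJ

variable {F : ExteriorAlgebra E (W₁ e) →ₛₗ[(σ : E →+* E)] ExteriorAlgebra E (W₁ e)}

-- Of the two vectors exactly one meets an odd argument, so the factor `λ⁻¹` does not depend on the
-- parity of `x`.
omit [NeZero (2 : E)] in
theorem vector_vector (hF : IsSpinJ b e a lam F) (v w : W) (x : ExteriorAlgebra E (W₁ e)) :
    F (vectorAction b e v (vectorAction b e w x)) = (algebraMap E₀ E lam)⁻¹ •
      vectorAction b e (conjJ σ e a v) (vectorAction b e (conjJ σ e a w) (F x)) := by
  obtain ⟨y, hy, z, hz, rfl⟩ := exists_even_add_odd x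
  simp only [map_add, smul_add]
  rw [hF.odd v _ (vectorAction_mem_odd w hy), hF.even w y hy,
    hF.even v _ (vectorAction_mem_even w hz), hF.odd w z hz, map_smul]

theorem sq_eq (hF : IsSpinJ b e a lam F) (x : ExteriorAlgebra E (W₁ e)) :
    F (F x) = parityScale e (algebraMap E₀ E (spinScalar m (∏ i, a (.inl i)) lam 0))
      (algebraMap E₀ E (spinScalar m (∏ i, a (.inl i)) lam 1)) x := by
  obtain ⟨y, hy, z, hz, rfl⟩ := exists_even_add_odd x
  rw [parityScale_add _ _ hy hz, map_add, map_add, hF.sq 0 y hy, hF.sq 1 z hz]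

theorem injective (hF : IsSpinJ b e a lam F) (he : IsGoodBasis b ψ e a lam) (hlam : lam ≠ 0) :
    Function.Injective F := by
  rw [injective_iff_map_eq_zero]
  intro x hx
  have h0 : ∀ ε, algebraMap E₀ E (spinScalar m (∏ i, a (.inl i)) lam ε) ≠ 0 := fun ε =>
    (map_ne_zero _).2 (he.spinScalar_ne_zero hlam m ε)
  have h1 := hF.sq_eq x
  rw [hx, map_zero] at h1
  obtain ⟨y, hy, z, hz, rfl⟩ := exists_even_add_odd x
  have h2 := congrArg (parityScale e (algebraMap E₀ E (spinScalar m (∏ i, a (.inl i)) lam 0))⁻¹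
      (algebraMap E₀ E (spinScalar m (∏ i, a (.inl i)) lam 1))⁻¹) h1
  rwa [parityScale_add _ _ hy hz, parityScale_add _ _ (Submodule.smul_mem _ _ hy)
    (Submodule.smul_mem _ _ hz), smul_smul, smul_smul, inv_mul_cancel₀ (h0 0),
    inv_mul_cancel₀ (h0 1), one_smul, one_smul, map_zero, eq_comm] at h2

theorem surjective (hF : IsSpinJ b e a lam F) (he : IsGoodBasis b ψ e a lam) (hlam : lam ≠ 0) :
    Function.Surjective F := by
  intro x
  have h0 : ∀ ε, algebraMap E₀ E (spinScalar m (∏ i, a (.inl i)) lam ε) ≠ 0 := fun ε =>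
    (map_ne_zero _).2 (he.spinScalar_ne_zero hlam m ε)
  obtain ⟨y, hy, z, hz, rfl⟩ := exists_even_add_odd x
  refine ⟨F ((algebraMap E₀ E (spinScalar m (∏ i, a (.inl i)) lam 0))⁻¹ • y +
    (algebraMap E₀ E (spinScalar m (∏ i, a (.inl i)) lam 1))⁻¹ • z), ?_⟩
  rw [hF.sq_eq, parityScale_add _ _ (Submodule.smul_mem _ _ hy)
    (Submodule.smul_mem _ _ hz), smul_smul, smul_smul, mul_inv_cancel₀ (h0 0),
    mul_inv_cancel₀ (h0 1), one_smul, one_smul]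

/-- Conjugation by the semilinear operator preserves the even Clifford algebra and is compatible
with its involution. -/
theorem exists_conj (hF : IsSpinJ b e a lam F) (h : IsStandardBasis b e)
    {z : CliffordAlgebra (quad b)} (hz : z ∈ CliffordAlgebra.evenOdd (quad b) 0) :
    ∃ y, (∀ x, F (spinAction h z x) = spinAction h y (F x)) ∧
      ∀ x, F (spinAction h (star z) x) = spinAction h (star y) (F x) := by
  induction z, hz using CliffordAlgebra.even_induction with
  | algebraMap r =>
    refine ⟨algebraMap E _ (σ r), fun x => ?_, fun x => ?_⟩
    · rw [AlgHom.commutes, AlgHom.commutes, Module.algebraMap_end_apply,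
        Module.algebraMap_end_apply, map_smulₛₗ]
      rfl
    · rw [CliffordAlgebra.star_algebraMap, CliffordAlgebra.star_algebraMap, AlgHom.commutes,
        AlgHom.commutes, Module.algebraMap_end_apply, Module.algebraMap_end_apply, map_smulₛₗ]
      rfl
  | add y z hy hz ihy ihz =>
    obtain ⟨y', h1, h2⟩ := ihy
    obtain ⟨z', h3, h4⟩ := ihz
    refine ⟨y' + z', fun x => ?_, fun x => ?_⟩
    · rw [map_add, map_add, LinearMap.add_apply, LinearMap.add_apply, map_add, h1, h3]
    · rw [star_add, star_add, map_add, map_add, LinearMap.add_apply, LinearMap.add_apply, map_add,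
        h2, h4]
  | ι_mul_ι_mul v w y hy ih =>
    obtain ⟨y', h1, h2⟩ := ih
    refine ⟨(algebraMap E₀ E lam)⁻¹ • (CliffordAlgebra.ι _ (conjJ σ e a v) *
      CliffordAlgebra.ι _ (conjJ σ e a w) * y'), fun x => ?_, fun x => ?_⟩
    · simp only [map_mul, map_smul, LinearMap.smul_apply, Module.End.mul_apply, spinAction_ι]
      rw [hF.vector_vector, h1]
    · simp only [CliffordAlgebra.star_smul, star_mul, CliffordAlgebra.star_ι, map_mul, map_smul,
        LinearMap.smul_apply, Module.End.mul_apply, spinAction_ι, map_neg, LinearMap.neg_apply,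
        neg_neg, h2]
      rw [hF.vector_vector]
      simp only [map_smul]

/-- Elements of the spin group over `G₀` commute with the semilinear operator up to sign. -/
theorem exists_sign (hF : IsSpinJ b e a lam F) (he : IsGoodBasis b ψ e a lam) (hlam : lam ≠ 0)
    (hσ : ∀ x, σ (σ x) = x) {g : spinGroup (quad b)} (hg : g ∈ preimageG₀ b ψ) :
    ∃ c : E, (c = 1 ∨ c = -1) ∧ ∀ x, F (spinAction he.standard g x) =
      c • spinAction he.standard g (F x) := by
  obtain ⟨g, hgs⟩ := g
  obtain ⟨T, hT, hgT⟩ := hg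
  set γ := spinAction he.standard with hγ
  set J := conjJ σ e a with hJ
  set l := algebraMap E₀ E lam with hl
  have hl0 : l ≠ 0 := by simpa [hl] using hlam
  set c₀ := algebraMap E₀ E (spinScalar m (∏ i, a (.inl i)) lam 0) with hc₀
  have hc₀0 : c₀ ≠ 0 := (map_ne_zero _).2 (he.spinScalar_ne_zero hlam m 0)
  have hc₁ : algebraMap E₀ E (spinScalar m (∏ i, a (.inl i)) lam 1) = c₀ * l := by
    rw [spinScalar_one, ← spinScalar_zero, map_mul]
  have hsg : star g * g = 1 := spinGroup.star_mul_self_of_mem hgs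
  have hgs' : g * star g = 1 := spinGroup.mul_star_self_of_mem hgs
  have hmem : ∀ {ε x}, x ∈ S e ε → γ g x ∈ S e ε := fun hx =>
    spinAction_mem he.standard (spinGroup.mem_even hgs) hx
  have hmem' : ∀ {ε x}, x ∈ S e ε → γ (star g) x ∈ S e ε := fun hx =>
    spinAction_mem he.standard (spinGroup.mem_even (spinGroup.star_mem hgs)) hx
  have hginv : ∀ x, γ g (γ (star g) x) = x := fun x => by
    rw [← Module.End.mul_apply, ← map_mul, hgs', map_one, Module.End.one_apply]
  have hginv' : ∀ x, γ (star g) (γ g x) = x := fun x => by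
    rw [← Module.End.mul_apply, ← map_mul, hsg, map_one, Module.End.one_apply]
  have h1 : ∀ v x, γ g (vectorAction b e v x) = vectorAction b e (T v) (γ g x) := by
    intro v x
    have := LinearMap.congr_fun (congrArg γ (hgT v)) x
    simpa only [map_mul, Module.End.mul_apply, hγ, spinAction_ι] using this
  have h2 : ∀ v x, γ (star g) (vectorAction b e (T v) x) =
      vectorAction b e v (γ (star g) x) := by
    intro v x
    rw [← hginv' (vectorAction b e v (γ (star g) x)), h1, hginv]
  -- `B = F g* F g` is linear. It behaves under vectors like `F²`, because `T` commutes with `J`.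
  -- Dividing by the scalars of `F²` gives an operator commuting with all vectors, hence a scalar.
  let B : Module.End E (ExteriorAlgebra E (W₁ e)) :=
    { toFun x := F (γ (star g) (F (γ g x)))
      map_add' x y := by simp only [map_add]
      map_smul' r x := by
        simp only [map_smul, map_smulₛₗ]
        exact congrArg (· • _) (hσ r) }
  have hB : ∀ x, B x = F (γ (star g) (F (γ g x))) := fun _ => rfl
  have hBmem : ∀ {ε x}, x ∈ S e ε → B x ∈ S e ε := fun hx =>
    hF.mem _ _ (hmem' (hF.mem _ _ (hmem hx)))
  obtain ⟨c, hc⟩ := exists_smul_of_commute he.standard (parityScale e c₀⁻¹ (c₀ * l)⁻¹ * B) <| by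
    intro v x
    obtain ⟨y, hy, z, hz, rfl⟩ := exists_even_add_odd x
    have hy' : B (vectorAction b e v y) = l • vectorAction b e v (B y) := by
      rw [hB, h1, hF.even _ _ (hmem hy), ← he.conjJ_comm hT, h2,
        hF.even _ _ (hmem' (hF.mem _ _ (hmem hy))), he.conjJ_conjJ hσ, map_smul]
      rfl
    have hz' : B (vectorAction b e v z) = l⁻¹ • l⁻¹ • l • vectorAction b e v (B z) := by
      rw [hB, h1, hF.odd _ _ (hmem hz), ← he.conjJ_comm hT, map_smul, h2, map_smulₛₗ,
        hF.odd _ _ (hmem' (hF.mem _ _ (hmem hz))), he.conjJ_conjJ hσ, map_smul, map_inv₀]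
      congr 2
      exact AlgEquiv.commutes σ lam
    simp only [Module.End.mul_apply, map_add, hy', hz', map_smul]
    rw [parityScale_odd _ _ (vectorAction_mem_odd v (hBmem hy)),
      parityScale_even _ _ (vectorAction_mem_even v (hBmem hz)),
      parityScale_even _ _ (hBmem hy), parityScale_odd _ _ (hBmem hz)]
    simp only [map_smul, smul_smul]
    congr 2
    · field_simp
    · field_simp
  have h3 : ∀ x, F (γ g x) = σ c • γ g (F x) := by
    intro x
    have hBx : B x = c • F (F x) := by
      obtain ⟨y, hy, z, hz, rfl⟩ := exists_even_add_odd x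
      have hy1 := hc y
      have hz1 := hc z
      rw [Module.End.mul_apply, parityScale_even _ _ (hBmem hy)] at hy1
      rw [Module.End.mul_apply, parityScale_odd _ _ (hBmem hz)] at hz1
      rw [hF.sq_eq, parityScale_add _ _ hy hz, hc₁, map_add, (inv_smul_eq_iff₀ hc₀0).1 hy1,
        (inv_smul_eq_iff₀ (mul_ne_zero hc₀0 hl0)).1 hz1, smul_add, smul_comm c, smul_comm c]
    have h4 : γ (star g) (F (γ g x)) = σ c • F x := by
      refine hF.injective he hlam ?_
      rw [← hB, hBx, map_smulₛₗ]
      exact congrArg (· • _) (hσ c).symm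
    rw [← hginv (F (γ g x)), h4, map_smul]
  -- Conjugation by `F` takes `g` to `y = σ(c) g` and, respecting the involution, `g*` to `y* = σ(c)
  -- g*`. Applied to `g* g = 1` this gives `σ(c)² = 1`.
  obtain ⟨y, hy1, hy2⟩ := hF.exists_conj he.standard (spinGroup.mem_even hgs)
  have h5 : y = σ c • g := by
    refine spinAction_injective he.standard (LinearMap.ext fun x => ?_)
    obtain ⟨x, rfl⟩ := hF.surjective he hlam x
    rw [← hy1, map_smul, LinearMap.smul_apply, ← h3]
  have h6 : F 1 = (σ c * σ c) • F 1 := by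
    have : F (γ (star g) (γ g 1)) = (σ c * σ c) • F 1 := by
      rw [hy2, h5, CliffordAlgebra.star_smul, map_smul, LinearMap.smul_apply, h3, map_smul,
        hginv', smul_smul]
    rwa [hginv'] at this
  have h7 : F 1 ≠ 0 := fun h0 =>
    one_ne_zero (hF.injective he hlam (h0.trans (map_zero F).symm))
  refine ⟨σ c, mul_self_eq_one_iff.1 ?_, h3⟩
  by_contra hne
  have : (σ c * σ c - 1) • F 1 = 0 := by rw [sub_smul, one_smul, ← h6, sub_self]
  exact (smul_eq_zero.1 this).elim (fun h => hne (sub_eq_zero.1 h)) h7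

variable [Module E₀ W] [IsScalarTower E₀ E W]

/-- `F` is `E₀`-linear though not `E`-linear, so the failure of the identity is detected by
`E₀`-linear functionals of `g`. This is where the topology over `E₀` matters. -/
theorem isOpen_ne (h : IsStandardBasis b e) (c : E₀) :
    @IsOpen _ (spinZariski E₀ b) {g : spinGroup (quad b) |
      ∃ x, F (spinAction h g x) ≠ algebraMap E₀ E c • spinAction h g (F x)} := by
  let _ := zariski E₀ (CliffordAlgebra (quad b))
  let _ := spinZariski E₀ b
  let L : ExteriorAlgebra E (W₁ e) → Module.Dual E (ExteriorAlgebra E (W₁ e)) →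
      Module.Dual E₀ E → Module.Dual E₀ (CliffordAlgebra (quad b)) := fun x φ p =>
    { toFun g := p (φ (F (spinAction h g x) - algebraMap E₀ E c • spinAction h g (F x)))
      map_add' g g' := by
        simp only [map_add, LinearMap.add_apply, map_sub, smul_add]
        abel
      map_smul' r g := by
        have hr : F (algebraMap E₀ E r • spinAction h g x) =
            algebraMap E₀ E r • F (spinAction h g x) := by
          rw [map_smulₛₗ]
          exact congrArg (· • _) (σ.commutes r)
        rw [← algebraMap_smul E r g, map_smul, LinearMap.smul_apply, LinearMap.smul_apply, hr,
          smul_comm (algebraMap E₀ E c), ← smul_sub, map_smul, algebraMap_smul, map_smul,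
          RingHom.id_apply] }
  have : {g : spinGroup (quad b) | ∃ x, F (spinAction h g x) ≠
      algebraMap E₀ E c • spinAction h g (F x)} = ⋃ (x) (φ) (p), Subtype.val ⁻¹'
        {g : CliffordAlgebra (quad b) | L x φ p g ≠ 0} := by
    ext g
    simp only [Set.mem_ofPred_eq, Set.mem_iUnion, Set.mem_preimage]
    refine exists_congr fun x => ⟨fun hx => ?_, ?_⟩
    · obtain ⟨φ, hφ⟩ := not_forall.1 (mt (Module.forall_dual_apply_eq_zero_iff E _).1
        (sub_ne_zero.2 hx))
      obtain ⟨p, hp⟩ := not_forall.1 (mt (Module.forall_dual_apply_eq_zero_iff E₀ _).1 hφ)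
      exact ⟨φ, p, hp⟩
    · rintro ⟨φ, p, hp⟩ hx
      refine hp ?_
      change p (φ (_ - _)) = 0
      rw [hx, sub_self, map_zero, map_zero]
  rw [this]
  refine isOpen_iUnion fun x => isOpen_iUnion fun φ => isOpen_iUnion fun p => ?_
  refine IsOpen.preimage continuous_induced_dom ?_
  exact TopologicalSpace.isOpen_generateFrom_of_mem
    ⟨L x φ p, Algebra.subset_adjoin ⟨L x φ p, rfl⟩, rfl⟩

/-- The group `G₁` commutes with the semilinear operator. -/
theorem commute_G₁ (hF : IsSpinJ b e a lam F) (he : IsGoodBasis b ψ e a lam) (hlam : lam ≠ 0)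
    (hσ : ∀ x, σ (σ x) = x) {g : spinGroup (quad b)} (hg : g ∈ G₁ (E₀ := E₀) b ψ)
    (x : ExteriorAlgebra E (W₁ e)) :
    F (spinAction he.standard g x) = spinAction he.standard g (F x) := by
  let _ := spinZariski E₀ b
  change g ∈ connectedComponentIn (preimageG₀ b ψ : Set (spinGroup (quad b))) 1 at hg
  have hP := connectedComponentIn_subset (preimageG₀ b ψ : Set (spinGroup (quad b))) 1
  have hsign : ∀ g ∈ preimageG₀ b ψ,
      (∀ x, F (spinAction he.standard g x) = algebraMap E₀ E 1 • spinAction he.standard g (F x)) ∨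
      ∀ x, F (spinAction he.standard g x) =
        algebraMap E₀ E (-1) • spinAction he.standard g (F x) := by
    intro g hg
    obtain ⟨c, rfl | rfl, hc⟩ := hF.exists_sign he hlam hσ hg
    · exact .inl fun x => by rw [hc, map_one]
    · exact .inr fun x => by rw [hc, map_neg, map_one]
  by_contra hne
  have h2 : (2 : E) ≠ 0 := NeZero.ne 2
  -- No `u` satisfies both identities: for `y` with `F y = u* · 1` they would give `1 = -1`.
  have hcover : (connectedComponentIn (preimageG₀ b ψ : Set (spinGroup (quad b))) 1) ⊆
      {g | ∃ x, F (spinAction he.standard g x) ≠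
        algebraMap E₀ E 1 • spinAction he.standard g (F x)} ∪
      {g | ∃ x, F (spinAction he.standard g x) ≠
        algebraMap E₀ E (-1) • spinAction he.standard g (F x)} := by
    intro u hu
    by_contra hnot
    simp only [Set.mem_union, Set.mem_ofPred_eq, not_or, not_exists, not_not] at hnot
    obtain ⟨h1, h1'⟩ := hnot
    obtain ⟨y, hy⟩ := hF.surjective he hlam
      (spinAction he.standard (star u : CliffordAlgebra (quad b)) 1)
    have h3 := (h1 y).symm.trans (h1' y)
    rw [hy, ← Module.End.mul_apply, ← map_mul, spinGroup.mul_star_self_of_mem u.2,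
      map_one (spinAction he.standard), Module.End.one_apply, map_neg, map_one, one_smul, neg_smul, one_smul,
      eq_neg_iff_add_eq_zero, ← two_smul E (1 : ExteriorAlgebra E (W₁ e)), smul_eq_zero] at h3
    exact h3.elim h2 one_ne_zero
  have hone : ∃ x, F (spinAction he.standard (1 : spinGroup (quad b)) x) ≠
      algebraMap E₀ E (-1) • spinAction he.standard (1 : spinGroup (quad b)) (F x) := by
    refine ⟨1, ?_⟩
    rw [Submonoid.coe_one, map_one (spinAction he.standard), Module.End.one_apply,
      Module.End.one_apply, map_neg, map_one (algebraMap E₀ E), neg_smul, one_smul, Ne, eq_neg_iff_add_eq_zero, ← two_smul E (F 1), smul_eq_zero]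
    rintro (h | h)
    · exact h2 h
    · exact one_ne_zero (hF.injective he hlam (h.trans (map_zero F).symm))
  -- The component meets the first open set in `g` and the second in `1`, so some `u` lies in both,
  -- contradicting `hsign`.
  obtain ⟨u, hu, ⟨x, hx⟩, ⟨y, hy⟩⟩ := isPreconnected_connectedComponentIn
    (F := (preimageG₀ b ψ : Set (spinGroup (quad b)))) (x := 1)
    _ _ (isOpen_ne (F := F) he.standard 1) (isOpen_ne (F := F) he.standard (-1)) hcover
    ⟨g, hg, x, by rwa [map_one, one_smul]⟩
    ⟨1, mem_connectedComponentIn (one_mem (preimageG₀ b ψ)), hone⟩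
  exact (hsign u (hP hu)).elim (fun h => hx (h x)) fun h => hy (h y)

end IsSpinJ

end Commutation

/-! ### Torus elements of the spin group -/

section Rotation

variable {E W : Type*} [Field E] [AddCommGroup W] [Module E W] {n : ℕ}
  {b : LinearMap.BilinForm E W} {e : Module.Basis (Fin n ⊕ Fin n) E W}

/-- For isotropic vectors `v, w` with `b(v, w) = 1`, this is an element of the spin group over the
rotation that multiplies `v` by `s²` and `w` by `s⁻²`. -/
def torusElt (b : LinearMap.BilinForm E W) (v w : W) (s : E) : CliffordAlgebra (quad b) :=
  s • (CliffordAlgebra.ι (quad b) v * CliffordAlgebra.ι (quad b) w) +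
    s⁻¹ • (CliffordAlgebra.ι (quad b) w * CliffordAlgebra.ι (quad b) v)

theorem ι_mul_ι_mem_spinGroup {u v : W} (hu : quad b u = 1) (hv : quad b v = 1) :
    CliffordAlgebra.ι (quad b) u * CliffordAlgebra.ι (quad b) v ∈ spinGroup (quad b) := by
  have hsq : ∀ {w}, quad b w = 1 →
      CliffordAlgebra.ι (quad b) w * CliffordAlgebra.ι (quad b) w = 1 := fun hw => by
    rw [CliffordAlgebra.ι_sq_scalar, hw, map_one]
  let U : ∀ {w}, quad b w = 1 → (CliffordAlgebra (quad b))ˣ := fun {w} hw =>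
    ⟨CliffordAlgebra.ι (quad b) w, CliffordAlgebra.ι (quad b) w, hsq hw, hsq hw⟩
  have hU : ∀ {w} (hw : quad b w = 1), U hw ∈ lipschitzGroup (quad b) := fun {w} hw =>
    Subgroup.subset_closure ⟨w, rfl⟩
  refine ⟨⟨⟨U hu * U hv, mul_mem (hU hu) (hU hv), rfl⟩, ?_⟩,
    CliffordAlgebra.ι_mul_ι_mem_evenOdd_zero (quad b) u v⟩
  rw [SetLike.mem_coe, Unitary.mem_iff, star_mul, CliffordAlgebra.star_ι, CliffordAlgebra.star_ι, neg_mul_neg]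
  constructor
  · rw [mul_assoc, ← mul_assoc _ _ (CliffordAlgebra.ι (quad b) v), hsq hu, one_mul, hsq hv]
  · rw [mul_assoc, ← mul_assoc _ _ (CliffordAlgebra.ι (quad b) u), hsq hv, one_mul, hsq hu]

section

variable [NeZero (2 : E)] {v w : W} (h : IsStandardBasis b e) (hv : b v v = 0) (hw : b w w = 0) (hvw : b v w = 1)
  {s : E} (hs : s ≠ 0)

include h hv hw hvw hs

omit h hvw hs in
theorem torusElt_eq_mul : torusElt b v w s =
    CliffordAlgebra.ι (quad b) (s • v + s⁻¹ • w) * CliffordAlgebra.ι (quad b) (v + w) := by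
  have hv2 : CliffordAlgebra.ι (quad b) v * CliffordAlgebra.ι (quad b) v = 0 := by
    rw [CliffordAlgebra.ι_sq_scalar, IsStandardBasis.quad_eq, hv, mul_zero, map_zero]
  have hw2 : CliffordAlgebra.ι (quad b) w * CliffordAlgebra.ι (quad b) w = 0 := by
    rw [CliffordAlgebra.ι_sq_scalar, IsStandardBasis.quad_eq, hw, mul_zero, map_zero]
  simp [torusElt, mul_add, add_mul, hv2, hw2, add_comm]

theorem torusElt_mem_spinGroup : torusElt b v w s ∈ spinGroup (quad b) := by
  have h2 : (2 : E) ≠ 0 := NeZero.ne 2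
  have hwv : b w v = 1 := by rw [h.symm, hvw]
  rw [torusElt_eq_mul hv hw]
  refine ι_mul_ι_mem_spinGroup ?_ ?_
  · rw [IsStandardBasis.quad_eq]
    simp only [map_add, map_smul, LinearMap.add_apply, LinearMap.smul_apply, hv, hw, hvw, hwv,
      smul_eq_mul]
    field_simp
    ring
  · rw [IsStandardBasis.quad_eq]
    simp only [map_add, LinearMap.add_apply, hv, hw, hvw, hwv]
    field_simp
    ring

omit [NeZero (2 : E)] hv in
/-- The rotation of the hyperbolic plane spanned by `v` and `w`. -/
theorem exists_rotation : ∃ T : W ≃ₗ[E] W,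
    (∀ x, T x = x + ((s ^ 2 - 1) * b w x) • v + ((s⁻¹ ^ 2 - 1) * b v x) • w) ∧
      LinearEquiv.det T = 1 := by
  have : Module.Finite E W := Module.Finite.of_basis e
  have hwv : b w v = 1 := by rw [h.symm, hvw]
  let T : W →ₗ[E] W := LinearMap.transvection ((s ^ 2 - 1) • b w) v ∘ₗ
    LinearMap.transvection ((s⁻¹ ^ 2 - 1) • b v) w
  have hT : ∀ x, T x = x + ((s ^ 2 - 1) * b w x) • v + ((s⁻¹ ^ 2 - 1) * b v x) • w := by
    intro x
    simp only [T, LinearMap.comp_apply, LinearMap.transvection.apply, LinearMap.smul_apply,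
      smul_eq_mul, map_add, map_smul, hw, mul_zero, zero_smul, add_zero]
  -- The two transvections have determinants `s²` and `s⁻²`.
  have hdet : LinearMap.det T = 1 := by
    rw [LinearMap.det_comp, LinearMap.transvection.det, LinearMap.transvection.det]
    simp only [LinearMap.smul_apply, hvw, hwv, smul_eq_mul, mul_one, add_sub_cancel]
    rw [← mul_pow, mul_inv_cancel₀ hs, one_pow]
  refine ⟨LinearMap.equivOfDetNeZero T (by rw [hdet]; exact one_ne_zero), hT, ?_⟩
  refine Units.ext ?_
  rw [LinearEquiv.coe_det]
  exact hdet

theorem torusElt_mul_ι (x : W) : torusElt b v w s * CliffordAlgebra.ι (quad b) x =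
    CliffordAlgebra.ι (quad b) (x + ((s ^ 2 - 1) * b w x) • v + ((s⁻¹ ^ 2 - 1) * b v x) • w) *
      torusElt b v w s := by
  have hv2 : CliffordAlgebra.ι (quad b) v * CliffordAlgebra.ι (quad b) v = 0 := by
    rw [CliffordAlgebra.ι_sq_scalar, IsStandardBasis.quad_eq, hv, mul_zero, map_zero]
  have hw2 : CliffordAlgebra.ι (quad b) w * CliffordAlgebra.ι (quad b) w = 0 := by
    rw [CliffordAlgebra.ι_sq_scalar, IsStandardBasis.quad_eq, hw, mul_zero, map_zero]
  have h1 := h.ι_anticomm v w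
  have h2 := h.ι_anticomm v x
  have h3 := h.ι_anticomm w x
  rw [hvw, map_one] at h1
  rw [Algebra.algebraMap_eq_smul_one] at h2 h3
  simp only [torusElt, map_add, map_smul]
  generalize CliffordAlgebra.ι (quad b) v = V at *
  generalize CliffordAlgebra.ι (quad b) w = U at *
  generalize CliffordAlgebra.ι (quad b) x = X at *
  generalize b v x = β at *
  generalize b w x = α at *
  have h2' : V * X = β • 1 - X * V := eq_sub_of_add_eq h2
  have h3' : U * X = α • 1 - X * U := eq_sub_of_add_eq h3
  have h4 : V * U * X = X * V * U + α • V - β • U := by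
    rw [mul_assoc, h3', mul_sub, ← mul_assoc, h2', sub_mul, mul_smul_comm, mul_one,
      smul_mul_assoc, one_mul]
    abel
  have h5 : U * V * X = X * U * V + β • U - α • V := by
    rw [mul_assoc, h2', mul_sub, ← mul_assoc, h3', sub_mul, mul_smul_comm, mul_one,
      smul_mul_assoc, one_mul]
    abel
  have h6 : V * U * V = V := by
    rw [mul_assoc, eq_sub_of_add_eq' h1, mul_sub, mul_one, ← mul_assoc, hv2, zero_mul, sub_zero]
  have h7 : U * V * U = U := by
    rw [mul_assoc, eq_sub_of_add_eq h1, mul_sub, mul_one, ← mul_assoc, hw2, zero_mul, sub_zero]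
  simp only [add_mul, mul_add, smul_mul_assoc, mul_smul_comm, ← mul_assoc, h4, h5, h6, h7, hv2,
    hw2, smul_zero, add_zero]
  match_scalars <;> field_simp <;> ring

end

end Rotation

/-! ### Rational curves are connected in the Zariski topology -/

section Curve

variable {k C : Type*} [Field k] [AddCommGroup C] [Module k C]

/-- A polynomial function restricted to the curve is a rational function of `t` whose only
denominators are powers of `1 - t² d`. -/
theorem exists_polynomial_of_polyFun {d : k} (hd : ∀ t : k, 1 - t ^ 2 * d ≠ 0) (y z : C)
    {p : C → k} (hp : p ∈ polyFun k C) : ∃ (N : ℕ) (P : Polynomial k), ∀ t,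
      (1 - t ^ 2 * d) ^ N * p ((1 - t ^ 2 * d)⁻¹ • ((1 + t ^ 2 * d) • y + t • z)) = P.eval t := by
  induction hp using Algebra.adjoin_induction with
  | mem q hq =>
    obtain ⟨φ, rfl⟩ := hq
    refine ⟨1, (1 + .X ^ 2 * .C d) * .C (φ y) + .X * .C (φ z), fun t => ?_⟩
    simp only [map_smul, map_add, smul_eq_mul, pow_one, Polynomial.eval_add, Polynomial.eval_mul,
      Polynomial.eval_pow, Polynomial.eval_X, Polynomial.eval_C, Polynomial.eval_one]
    rw [mul_inv_cancel_left₀ (hd t)]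
  | algebraMap r => exact ⟨0, .C r, fun t => by simp⟩
  | add p q _ _ hp hq =>
    obtain ⟨N, P, hP⟩ := hp
    obtain ⟨M, Q, hQ⟩ := hq
    refine ⟨N + M, (1 - .X ^ 2 * .C d) ^ M * P + (1 - .X ^ 2 * .C d) ^ N * Q, fun t => ?_⟩
    simp only [Pi.add_apply, Polynomial.eval_add, Polynomial.eval_mul, Polynomial.eval_sub,
      Polynomial.eval_pow, Polynomial.eval_X, Polynomial.eval_C, Polynomial.eval_one, ← hP, ← hQ]
    ring
  | mul p q _ _ hp hq =>
    obtain ⟨N, P, hP⟩ := hp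
    obtain ⟨M, Q, hQ⟩ := hq
    refine ⟨N + M, P * Q, fun t => ?_⟩
    simp only [Pi.mul_apply, Polynomial.eval_mul, ← hP, ← hQ]
    ring

/-- A rational curve in a vector space is irreducible for the Zariski topology. -/
theorem isPreconnected_curve [Infinite k] {X : Type*} (f : X → C) {d : k}
    (hd : ∀ t : k, 1 - t ^ 2 * d ≠ 0) (y z : C) (c : k → X)
    (hc : ∀ t, f (c t) = (1 - t ^ 2 * d)⁻¹ • ((1 + t ^ 2 * d) • y + t • z)) :
    @IsPreconnected X ((zariski k C).induced f) (Set.range c) := by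
  let _ := zariski k C
  let _ := (zariski k C).induced f
  -- A nonzero polynomial has finitely many roots, so the parametrization is continuous for the
  -- cofinite topology, which is irreducible on an infinite field.
  have hcont : Continuous (f ∘ c ∘ CofiniteTopology.of.symm) := by
    refine continuous_generateFrom_iff.2 ?_
    rintro _ ⟨p, hp, rfl⟩
    obtain ⟨N, P, hP⟩ := exists_polynomial_of_polyFun hd y z hp
    have hset : ∀ t, p (f (c t)) ≠ 0 ↔ P.eval t ≠ 0 := fun t => by
      rw [← hP, ← hc, mul_ne_zero_iff, and_iff_right (pow_ne_zero N (hd t))]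
    rw [CofiniteTopology.isOpen_iff']
    by_cases hP0 : P = 0
    · left
      ext t
      simp [hset, hP0]
    · right
      refine ((P.rootSet_finite k).preimage
        (CofiniteTopology.of.symm.injective.injOn)).subset fun t ht => ?_
      have := not_not.1 (mt (hset _).2 ht)
      simpa [Polynomial.mem_rootSet, hP0] using this
  have hcont' : Continuous (c ∘ CofiniteTopology.of.symm) := continuous_induced_rng.2 hcont
  refine IsPreirreducible.isPreconnected ?_
  rintro u v hu hv ⟨_, ⟨t, rfl⟩, htu⟩ ⟨_, ⟨t', rfl⟩, htv⟩
  have h1 := CofiniteTopology.isOpen_iff.1 (hu.preimage hcont') ⟨CofiniteTopology.of t, htu⟩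
  have h2 := CofiniteTopology.isOpen_iff.1 (hv.preimage hcont') ⟨CofiniteTopology.of t', htv⟩
  have : Infinite (CofiniteTopology k) := CofiniteTopology.of.infinite_iff.1 ‹_›
  obtain ⟨r, hr⟩ := (h1.union h2).infinite_compl.nonempty
  simp only [Set.compl_union, compl_compl] at hr
  exact ⟨_, ⟨_, rfl⟩, hr⟩

end Curve

/-! ### Torus elements in `G₁` and Schur's lemma for the half spin modules -/

section Generators

variable {E₀ E W : Type*} [Field E₀] [Field E] [Algebra E₀ E] [AddCommGroup W] [Module E W]
  [NeZero (2 : E)] {σ : E ≃ₐ[E₀] E} {m : ℕ} {b : LinearMap.BilinForm E W}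
  {ψ : W →ₗ[E] W →ₛₗ[(σ : E →+* E)] E} {lam : E₀}
  {e : Module.Basis (Fin (2 * m) ⊕ Fin (2 * m)) E W} {a : Fin (2 * m) ⊕ Fin (2 * m) → E₀}

/-- `J` exchanges the lines of `v` and `w`, where the rotation has eigenvalues `s²` and `s⁻²`. Being
semilinear, it commutes with the rotation because `σ(s) = s⁻¹`, and so `ψ` is preserved. -/
theorem torusElt_mem_preimageG₀ (he : IsGoodBasis b ψ e a lam) (hlam : lam ≠ 0)
    (hσ : ∀ x, σ (σ x) = x) {v w : W} (hv : b v v = 0) (hψ : ψ v v ≠ 0)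
    (hwdef : w = (ψ v v)⁻¹ • conjJ σ e a v) {s : E} (hs : s * σ s = 1)
    (hmem : torusElt b v w s ∈ spinGroup (quad b)) :
    (⟨_, hmem⟩ : spinGroup (quad b)) ∈ preimageG₀ b ψ := by
  have hs0 : s ≠ 0 := left_ne_zero_of_mul_eq_one hs
  have hσs : σ s = s⁻¹ := eq_inv_of_mul_eq_one_right hs
  have hl0 : algebraMap E₀ E lam ≠ 0 := (map_ne_zero _).2 hlam
  set J := conjJ σ e a with hJ
  set η := ψ v v with hη
  have hbη : b v (J v) = η := (he.ψ_eq v v).symm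
  have hση : σ η = η := by
    rw [hη, he.diagonal, map_sum]
    refine Finset.sum_congr rfl fun r _ => ?_
    rw [map_mul, map_mul, AlgEquiv.commutes, hσ, mul_right_comm]
  have hJv : J v = η • w := by rw [hwdef, smul_smul, mul_inv_cancel₀ hψ, one_smul]
  have hJw : J w = (η⁻¹ * algebraMap E₀ E lam) • v := by
    rw [hwdef, map_smulₛₗ, hJ, he.conjJ_conjJ hσ, smul_smul, RingHom.coe_coe, map_inv₀, hση]
  have hvw : b v w = 1 := by rw [hwdef, map_smul, hbη, smul_eq_mul, inv_mul_cancel₀ hψ]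
  have hwv : b w v = 1 := by rw [he.standard.symm, hvw]
  have hw : b w w = 0 := by
    rw [hwdef]
    simp only [map_smul, LinearMap.smul_apply, hJ, he.b_conjJ, hv, map_zero, mul_zero, smul_zero]
  obtain ⟨T, hT, hdet⟩ := exists_rotation he.standard hw hvw hs0
  have hTb : ∀ x y, b (T x) (T y) = b x y := by
    intro x y
    rw [hT, hT]
    simp only [map_add, map_smul, LinearMap.add_apply, LinearMap.smul_apply, smul_eq_mul, hv, hw,
      hvw, hwv, he.standard.symm x v, he.standard.symm x w]
    field_simp
    ring
  have hTJ : ∀ y, J (T y) = T (J y) := by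
    intro y
    have h1 : η * b w (J y) = algebraMap E₀ E lam * σ (b v y) := by
      rw [← he.b_conjJ, ← hJ, hJv, map_smul, LinearMap.smul_apply, smul_eq_mul]
    have h2 : η⁻¹ * algebraMap E₀ E lam * b v (J y) = algebraMap E₀ E lam * σ (b w y) := by
      rw [← he.b_conjJ, ← hJ, hJw, map_smul, LinearMap.smul_apply, smul_eq_mul]
    have h3 : b w (J y) = η⁻¹ * (algebraMap E₀ E lam * σ (b v y)) := by
      rw [← h1, inv_mul_cancel_left₀ hψ]
    have h4 : b v (J y) = η * σ (b w y) := by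
      field_simp at h2
      rw [h2]
    rw [hT, hT, map_add, map_add, map_smulₛₗ, map_smulₛₗ, hJv, hJw, h3, h4]
    simp only [RingHom.coe_coe, map_mul, map_sub, map_pow, map_inv₀, map_one, hσs, inv_inv,
      smul_smul]
    module
  refine ⟨T, ⟨hdet, hTb, fun x y => ?_⟩, fun x => ?_⟩
  · rw [he.ψ_eq, he.ψ_eq, ← hJ, hTJ, hTb]
  · rw [hT]
    exact torusElt_mul_ι he.standard hv hw hvw hs0 x

variable [Module E₀ W] [IsScalarTower E₀ E W] [Infinite E₀]

theorem exists_torusElt_mem_G₁ (he : IsGoodBasis b ψ e a lam) (hlam : lam ≠ 0)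
    (hσ : ∀ x, σ (σ x) = x) {δ : E} (hδ : σ δ = -δ) (hδ0 : δ ≠ 0) {d : E₀}
    (hd : algebraMap E₀ E d = δ ^ 2) {v w : W} (hv : b v v = 0) (hψ : ψ v v ≠ 0)
    (hwdef : w = (ψ v v)⁻¹ • conjJ σ e a v) :
    ∃ s : E, s ≠ s⁻¹ ∧ ∃ hmem : torusElt b v w s ∈ spinGroup (quad b), (⟨_, hmem⟩ : spinGroup (quad b)) ∈ G₁ (E₀ := E₀) b ψ := by
  have h2 : (2 : E) ≠ 0 := NeZero.ne 2
  have hvw : b v w = 1 := by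
    rw [hwdef, map_smul, ← he.ψ_eq, smul_eq_mul, inv_mul_cancel₀ hψ]
  have hw : b w w = 0 := by
    rw [hwdef]
    simp only [map_smul, LinearMap.smul_apply, he.b_conjJ, hv, map_zero, mul_zero, smul_zero]
  have hsub : ∀ t : E₀, 1 - algebraMap E₀ E t * δ ≠ 0 := by
    intro t ht
    have h1 := congrArg σ ht
    rw [map_sub, map_one, map_mul, AlgEquiv.commutes, hδ, map_zero] at h1
    exact h2 (by linear_combination ht + h1)
  have hadd : ∀ t : E₀, 1 + algebraMap E₀ E t * δ ≠ 0 := by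
    intro t ht
    exact hsub (-t) (by rw [map_neg]; linear_combination ht)
  -- The rational parametrization of elements of norm one. At `t = 0` the torus element is `1`, so
  -- the whole curve lies in the neutral component.
  let s : E₀ → E := fun t => (1 + algebraMap E₀ E t * δ) / (1 - algebraMap E₀ E t * δ)
  have hs0 : ∀ t, s t ≠ 0 := fun t => div_ne_zero (hadd t) (hsub t)
  have hs1 : ∀ t, s t * σ (s t) = 1 := by
    intro t
    simp only [s, map_div₀, map_add, map_sub, map_one, map_mul, AlgEquiv.commutes, hδ]
    have h3 := hsub t
    have h4 := hadd t
    rw [mul_neg, sub_neg_eq_add, ← sub_eq_add_neg]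
    field_simp
  have hd' : ∀ t : E₀, 1 - t ^ 2 * d ≠ 0 := by
    intro t ht
    have h3 := congrArg (algebraMap E₀ E) ht
    rw [map_sub, map_one, map_mul, map_pow, hd, map_zero] at h3
    exact mul_ne_zero (hsub t) (hadd t) (by linear_combination h3)
  have hmem : ∀ t, torusElt b v w (s t) ∈ spinGroup (quad b) := fun t =>
    torusElt_mem_spinGroup he.standard hv hw hvw (hs0 t)
  have hwv1 := he.standard.ι_anticomm v w
  rw [hvw, map_one] at hwv1
  have hcurve : ∀ t, torusElt b v w (s t) = (1 - t ^ 2 * d)⁻¹ • ((1 + t ^ 2 * d) •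
      (1 : CliffordAlgebra (quad b)) + t • ((2 * δ) • (CliffordAlgebra.ι (quad b) v *
        CliffordAlgebra.ι (quad b) w - CliffordAlgebra.ι (quad b) w *
        CliffordAlgebra.ι (quad b) v))) := by
    intro t
    have h3 := hsub t
    have h4 := hadd t
    have h5 : 1 - algebraMap E₀ E t ^ 2 * δ ^ 2 ≠ 0 := by
      intro h
      exact mul_ne_zero h3 h4 (by linear_combination h)
    rw [← algebraMap_smul E (1 - t ^ 2 * d)⁻¹, ← algebraMap_smul E (1 + t ^ 2 * d),
      ← algebraMap_smul E t, torusElt, ← hwv1]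
    simp only [s, map_inv₀, map_sub, map_add, map_one, map_mul, map_pow, hd, inv_div]
    match_scalars
    · field_simp
      ring
    · field_simp
      ring
  have hpre : @IsPreconnected _ (spinZariski E₀ b)
      (Set.range fun t => (⟨_, hmem t⟩ : spinGroup (quad b))) :=
    isPreconnected_curve Subtype.val hd' _ _ (fun t => (⟨_, hmem t⟩ : spinGroup (quad b))) hcurve
  let _ := spinZariski E₀ b
  have hsubset := hpre.subset_connectedComponentIn (x := 1)
    (F := (preimageG₀ b ψ : Set (spinGroup (quad b)))) ⟨0, ?_⟩ ?_
  -- The parameter `t = 1` already suffices: `s = s⁻¹` would force `4δ = 0`.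
  · refine ⟨s 1, ?_, hmem 1, hsubset ⟨1, rfl⟩⟩
    intro h
    have h3 := hsub 1
    have h4 := hadd 1
    simp only [s, map_one, one_mul, inv_div] at h h3 h4
    rw [div_eq_div_iff h3 h4] at h
    have h5 : 2 * 2 * δ = 0 := by linear_combination h
    exact mul_ne_zero (mul_ne_zero h2 h2) hδ0 h5
  · refine Subtype.ext ?_
    change torusElt b v w (s 0) = 1
    rw [torusElt, ← hwv1]
    simp [s]
  · rintro _ ⟨t, rfl⟩
    exact torusElt_mem_preimageG₀ he hlam hσ hv hψ hwdef (hs1 t) (hmem t)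

/-- A torus element is `s⁻¹ + (s - s⁻¹) v w`. As `s ≠ s⁻¹`, commuting with it amounts to commuting
with `v w`, and `J v` is a multiple of `w`. -/
theorem commute_vectorAction_conjJ (he : IsGoodBasis b ψ e a lam) (hlam : lam ≠ 0)
    (hσ : ∀ x, σ (σ x) = x) {δ : E} (hδ : σ δ = -δ) (hδ0 : δ ≠ 0) {d : E₀}
    (hd : algebraMap E₀ E d = δ ^ 2) {A : Module.End E (ExteriorAlgebra E (W₁ e))}
    (hA : ∀ g ∈ G₁ (E₀ := E₀) b ψ, Commute A (spinAction he.standard g))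
    {v : W} (hv : b v v = 0) (hψ : ψ v v ≠ 0) :
    Commute A (vectorAction b e v * vectorAction b e (conjJ σ e a v)) := by
  obtain ⟨w, hwdef⟩ : ∃ w, w = (ψ v v)⁻¹ • conjJ σ e a v := ⟨_, rfl⟩
  obtain ⟨s, hs, hmem, hG⟩ := exists_torusElt_mem_G₁ he hlam hσ hδ hδ0 hd hv hψ hwdef
  have hcomm := hA _ hG
  have hvw : b v w = 1 := by
    rw [hwdef, map_smul, ← he.ψ_eq, smul_eq_mul, inv_mul_cancel₀ hψ]
  have h1 := he.standard.ι_anticomm v w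
  rw [hvw, map_one] at h1
  have h2 : torusElt b v w s = s⁻¹ • 1 + (s - s⁻¹) •
      (CliffordAlgebra.ι (quad b) v * CliffordAlgebra.ι (quad b) w) := by
    rw [torusElt, ← h1]
    module
  have h3 : conjJ σ e a v = ψ v v • w := by
    rw [hwdef, smul_smul, mul_inv_cancel₀ hψ, one_smul]
  have h4 : vectorAction b e v * vectorAction b e w = (s - s⁻¹)⁻¹ •
      (spinAction he.standard (torusElt b v w s) - s⁻¹ • 1) := by
    rw [h2, map_add, map_smul, map_smul, map_one, add_sub_cancel_left, smul_smul,
      inv_mul_cancel₀ (sub_ne_zero.2 hs), one_smul, map_mul, spinAction_ι, spinAction_ι]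
  rw [h3, map_smul, mul_smul_comm, h4]
  exact ((hcomm.sub_right ((Commute.one_right A).smul_right _)).smul_right _).smul_right _

/-- Polarization of `v J(v)` along the isotropic vectors `e_r + t e_p`. The mixed terms carry `σ(t)`
and `t`, and are separated by comparing `t` with `t δ`. -/
theorem commute_vectorAction_basis (he : IsGoodBasis b ψ e a lam) (hlam : lam ≠ 0)
    (hσ : ∀ x, σ (σ x) = x) {δ : E} (hδ : σ δ = -δ) (hδ0 : δ ≠ 0) {d : E₀}
    (hd : algebraMap E₀ E d = δ ^ 2) {A : Module.End E (ExteriorAlgebra E (W₁ e))}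
    (hA : ∀ g ∈ G₁ (E₀ := E₀) b ψ, Commute A (spinAction he.standard g))
    (r q : Fin (2 * m) ⊕ Fin (2 * m)) :
    Commute A (vectorAction b e (e r) * vectorAction b e (e q)) := by
  have h2 : (2 : E) ≠ 0 := NeZero.ne 2
  have ha : ∀ r, a r ≠ 0 := fun r hr => hlam (by rw [← he.mul_swap r, hr, zero_mul])
  have ha' : ∀ r, algebraMap E₀ E (a r) ≠ 0 := fun r => (map_ne_zero _).2 (ha r)
  have hb : ∀ r q, q ≠ r.swap → b (e r) (e q) = 0 := fun r q hrq => by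
    rw [he.standard.apply_basis_left, Module.Basis.repr_self, Finsupp.single_eq_of_ne hrq.symm]
  have hb0 : ∀ r, b (e r) (e r) = 0 := fun r => hb r r (by cases r <;> simp)
  have hψe : ∀ r q, ψ (e r) (e q) = algebraMap E₀ E (a q) * b (e r) (e q.swap) := by
    intro r q
    rw [he.ψ_eq, conjJ_basis, map_smul, smul_eq_mul]
  have hb1 : ∀ r, b (e r) (e r.swap) = 1 := fun r => by
    rw [he.standard.apply_basis_left, Module.Basis.repr_self, Finsupp.single_eq_same]
  have hdiag : ∀ r, Commute A (vectorAction b e (e r) * vectorAction b e (e r.swap)) := by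
    intro r
    have := commute_vectorAction_conjJ he hlam hσ hδ hδ0 hd hA (hb0 r)
      (by rw [hψe, hb1, mul_one]; exact ha' r)
    rw [conjJ_basis, map_smul, mul_smul_comm] at this
    exact (Commute.smul_right_iff₀ (ha' r)).1 this
  by_cases hqr : q = r
  · subst hqr
    rw [vectorAction_sq he.standard, IsStandardBasis.quad_eq, hb0, mul_zero, map_zero]
    exact Commute.zero_right A
  by_cases hqr' : q = r.swap
  · exact hqr' ▸ hdiag r
  obtain ⟨p, rfl⟩ : ∃ p : Fin (2 * m) ⊕ Fin (2 * m), q = p.swap := ⟨q.swap, q.swap_swap.symm⟩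
  have hpr : p ≠ r := fun h => hqr' (h ▸ rfl)
  have hpr' : p ≠ r.swap := fun h => hqr (by rw [h, Sum.swap_swap])
  have hrp : r ≠ p.swap := Ne.symm hqr
  have hinj := (Function.LeftInverse.injective (@Sum.swap_swap (Fin (2 * m)) (Fin (2 * m))))
  have hmain : ∀ t : E, algebraMap E₀ E (a r) + t * σ t * algebraMap E₀ E (a p) ≠ 0 →
      Commute A ((σ t * algebraMap E₀ E (a p)) •
          (vectorAction b e (e r) * vectorAction b e (e p.swap)) +
        (t * algebraMap E₀ E (a r)) •
          (vectorAction b e (e p) * vectorAction b e (e r.swap))) := by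
    intro t ht
    have hiso : b (e r + t • e p) (e r + t • e p) = 0 := by
      simp only [map_add, map_smul, LinearMap.add_apply, LinearMap.smul_apply, hb0, hb r p hpr',
        hb p r hrp, smul_zero, add_zero]
    have hψt : ψ (e r + t • e p) (e r + t • e p) ≠ 0 := by
      simp only [map_add, map_smul, map_smulₛₗ, LinearMap.add_apply, LinearMap.smul_apply, hψe,
        hb1, smul_eq_mul, hb r p.swap (fun h => hpr (hinj h)),
        hb p r.swap (fun h => hpr (hinj h).symm), RingHom.coe_coe]
      intro h0
      exact ht (by linear_combination h0)
    have h1 := commute_vectorAction_conjJ he hlam hσ hδ hδ0 hd hA hiso hψt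
    have h3 := (h1.sub_right ((hdiag r).smul_right (algebraMap E₀ E (a r)))).sub_right
      ((hdiag p).smul_right (t * σ t * algebraMap E₀ E (a p)))
    convert! h3 using 1
    simp only [map_add, map_smul, map_smulₛₗ, conjJ_basis, RingHom.coe_coe, add_mul, mul_add,
      smul_mul_assoc, mul_smul_comm]
    module
  -- The last two conditions say that `ψ(v, v) ≠ 0` for `v = e_r + t e_p` and `v = e_r + t δ e_p`.
  obtain ⟨t, ht0, ht1, ht2⟩ : ∃ t : E₀, t ≠ 0 ∧ a r + t ^ 2 * a p ≠ 0 ∧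
      a r - t ^ 2 * d * a p ≠ 0 := by
    let P : Polynomial E₀ := .X * (.C (a r) + .X ^ 2 * .C (a p)) *
      (.C (a r) - .X ^ 2 * .C d * .C (a p))
    have hP : P ≠ 0 := by
      refine mul_ne_zero (mul_ne_zero Polynomial.X_ne_zero fun h => ha r ?_) fun h => ha r ?_
      · simpa using congrArg (Polynomial.eval 0) h
      · simpa using congrArg (Polynomial.eval 0) h
    obtain ⟨t, ht⟩ := (P.exists_eval_ne_zero_of_natDegree_lt_card hP
      (Cardinal.natCast_lt_aleph0.trans_le (Cardinal.infinite_iff.1 ‹_›)))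
    simp only [P, Polynomial.eval_mul, Polynomial.eval_add, Polynomial.eval_sub,
      Polynomial.eval_pow, Polynomial.eval_X, Polynomial.eval_C, mul_ne_zero_iff] at ht
    exact ⟨t, ht.1.1, ht.1.2, ht.2⟩
  have hτ0 : algebraMap E₀ E t ≠ 0 := (map_ne_zero _).2 ht0
  have h3 := hmain (algebraMap E₀ E t) (by
    rw [AlgEquiv.commutes, ← map_mul, ← map_mul, ← map_add]
    exact (map_ne_zero _).2 (by rwa [← pow_two]))
  have h4 := hmain (algebraMap E₀ E t * δ) (by
    have : algebraMap E₀ E (a r) + algebraMap E₀ E t * δ * σ (algebraMap E₀ E t * δ) *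
        algebraMap E₀ E (a p) = algebraMap E₀ E (a r - t ^ 2 * d * a p) := by
      rw [map_mul σ, AlgEquiv.commutes, hδ, map_sub, map_mul, map_mul, map_pow, hd]
      ring
    rw [this]
    exact (map_ne_zero _).2 ht2)
  rw [map_mul σ, AlgEquiv.commutes, hδ] at h4
  rw [AlgEquiv.commutes] at h3
  -- The terms in `e_p e_{r.swap}` cancel, leaving `2 t δ a_p` times `e_r e_{p.swap}`.
  have h5 := (h3.smul_right δ).sub_right h4
  have h6 : (2 * algebraMap E₀ E t * δ * algebraMap E₀ E (a p)) ≠ 0 :=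
    mul_ne_zero (mul_ne_zero (mul_ne_zero h2 hτ0) hδ0) (ha' p)
  refine (Commute.smul_right_iff₀ h6).1 ?_
  convert! h5 using 1
  module

/-- An endomorphism of the spin module that commutes with `G₁` and vanishes on one of the half spin
modules is a scalar on the other. -/
theorem exists_smul_of_commute_G₁ (he : IsGoodBasis b ψ e a lam) (hlam : lam ≠ 0)
    (hm : 1 ≤ m) (hσ : ∀ x, σ (σ x) = x) {δ : E} (hδ : σ δ = -δ) (hδ0 : δ ≠ 0) {d : E₀}
    (hd : algebraMap E₀ E d = δ ^ 2) {A : Module.End E (ExteriorAlgebra E (W₁ e))}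
    (hA : ∀ g ∈ G₁ (E₀ := E₀) b ψ, Commute A (spinAction he.standard g)) (ε : ZMod 2)
    (hA0 : ∀ x ∈ S e (1 + ε), A x = 0) : ∃ u : E, ∀ x ∈ S e ε, A x = u • x := by
  have h2 : (2 : E) ≠ 0 := NeZero.ne 2
  have hvw : ∀ v w, Commute A (vectorAction b e v * vectorAction b e w) := by
    intro v w
    rw [← e.sum_repr v, ← e.sum_repr w, map_sum, map_sum, Finset.sum_mul_sum]
    refine Commute.sum_right _ _ _ fun r _ => Commute.sum_right _ _ _ fun q _ => ?_
    rw [map_smul, map_smul, smul_mul_smul_comm]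
    exact (commute_vectorAction_basis he hlam hσ hδ hδ0 hd hA r q).smul_right _
  let i : Fin (2 * m) := ⟨0, by omega⟩
  -- A vector with `v₀² = 1`. Since `A` commutes with products of two vectors, `A + v₀ A v₀`
  -- commutes with every single vector, so it is a scalar. On `S e ε` its second term vanishes.
  let v₀ := e (.inl i) + e (.inr i)
  have hv₀ : vectorAction b e v₀ * vectorAction b e v₀ = 1 := by
    have : quad b v₀ = 1 := by
      rw [IsStandardBasis.quad_eq]
      simp [v₀, he.standard.apply_basis_left]
      field_simp
      ring
    rw [vectorAction_sq he.standard, this, map_one]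
  obtain ⟨u, hu⟩ := exists_smul_of_commute he.standard
    (A + vectorAction b e v₀ * A * vectorAction b e v₀) fun v x => by
      have h3 : A * vectorAction b e v =
          vectorAction b e v * vectorAction b e v₀ * A * vectorAction b e v₀ := by
        rw [← (hvw v v₀).eq, mul_assoc, mul_assoc, hv₀, mul_one]
      have h4 : vectorAction b e v₀ * A * vectorAction b e v₀ * vectorAction b e v =
          vectorAction b e v * A := by
        rw [mul_assoc, mul_assoc, (hvw v₀ v).eq, ← mul_assoc, ← mul_assoc, hv₀, one_mul]
      have h5 : (A + vectorAction b e v₀ * A * vectorAction b e v₀) * vectorAction b e v =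
          vectorAction b e v * (A + vectorAction b e v₀ * A * vectorAction b e v₀) := by
        rw [add_mul, mul_add, h4, h3, add_comm, mul_assoc, mul_assoc, mul_assoc]
      exact LinearMap.congr_fun h5 x
  refine ⟨u, fun x hx => ?_⟩
  rw [← hu, LinearMap.add_apply, Module.End.mul_apply, Module.End.mul_apply,
    hA0 _ (vectorAction_mem b e v₀ hx), map_zero, add_zero]

end Generators

/-! ### Quadratic extensions, norms and Galois descent -/

theorem charZero_of_algebra (E₀ E : Type*) [Field E₀] [Field E] [CharZero E] [Algebra E₀ E] :
    CharZero E₀ :=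
  (algebraMap E₀ E).charZero

section Quadratic

variable {E₀ E : Type*} [Field E₀] [Field E] [CharZero E] [Algebra E₀ E]
  [Algebra.IsQuadraticExtension E₀ E] {σ : E ≃ₐ[E₀] E}

theorem card_gal : Nat.card (E ≃ₐ[E₀] E) = 2 := by
  have : CharZero E₀ := charZero_of_algebra E₀ E
  rw [IsGalois.card_aut_eq_finrank, Algebra.IsQuadraticExtension.finrank_eq_two]

theorem conj_conj (σ : E ≃ₐ[E₀] E) (x : E) : σ (σ x) = x := by
  have h := pow_card_eq_one' (x := σ)
  rw [card_gal, pow_two] at h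
  exact AlgEquiv.congr_fun h x

theorem eq_refl_or_eq (hσ : σ ≠ AlgEquiv.refl) (τ : E ≃ₐ[E₀] E) : τ = AlgEquiv.refl ∨ τ = σ := by
  have : Fintype (E ≃ₐ[E₀] E) := Fintype.ofFinite _
  classical
  by_contra! h
  have h3 : ({AlgEquiv.refl, σ, τ} : Finset (E ≃ₐ[E₀] E)).card = 3 := by
    rw [Finset.card_eq_three]
    exact ⟨_, _, _, hσ.symm, h.1.symm, h.2.symm, rfl⟩
  have h4 := Finset.card_le_univ ({AlgEquiv.refl, σ, τ} : Finset (E ≃ₐ[E₀] E))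
  rw [h3, ← Nat.card_eq_fintype_card, card_gal] at h4
  omega

theorem norm_eq (hσ : σ ≠ AlgEquiv.refl) (x : E) :
    algebraMap E₀ E (Algebra.norm E₀ x) = x * σ x := by
  have : CharZero E₀ := charZero_of_algebra E₀ E
  classical
  have huniv : (Finset.univ : Finset (E ≃ₐ[E₀] E)) = {AlgEquiv.refl, σ} := by
    ext τ
    simpa using eq_refl_or_eq hσ τ
  rw [Algebra.norm_eq_prod_automorphisms, huniv, Finset.prod_pair hσ.symm]
  rfl

theorem exists_of_conj_eq (hσ : σ ≠ AlgEquiv.refl) {x : E} (hx : σ x = x) :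
    ∃ y, algebraMap E₀ E y = x := by
  have : CharZero E₀ := charZero_of_algebra E₀ E
  refine (IsGalois.mem_range_algebraMap_iff_fixed x).2 fun τ => ?_
  rcases eq_refl_or_eq hσ τ with rfl | rfl
  · rfl
  · exact hx

theorem exists_antiinvariant (hσ : σ ≠ AlgEquiv.refl) : ∃ δ : E, σ δ = -δ ∧ δ ≠ 0 := by
  by_contra! h
  refine hσ (AlgEquiv.ext fun x => ?_)
  have := h (σ x - x) (by rw [map_sub, conj_conj, neg_sub])
  exact sub_eq_zero.1 this

theorem exists_eq_add_mul (hσ : σ ≠ AlgEquiv.refl) {δ : E} (hδ : σ δ = -δ) (hδ0 : δ ≠ 0) (x : E) :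
    ∃ y z : E₀, x = algebraMap E₀ E y + algebraMap E₀ E z * δ := by
  obtain ⟨y, hy⟩ := exists_of_conj_eq hσ (x := (x + σ x) / 2) (by
    rw [map_div₀, map_add, conj_conj, add_comm, map_ofNat])
  obtain ⟨z, hz⟩ := exists_of_conj_eq hσ (x := (x - σ x) / (2 * δ)) (by
    rw [map_div₀, map_sub, conj_conj, map_mul, hδ, map_ofNat]
    field_simp
    ring)
  refine ⟨y, z, ?_⟩
  rw [hy, hz]
  field_simp
  ring

theorem isNorm_iff (hσ : σ ≠ AlgEquiv.refl) {x : E₀} (hx : x ≠ 0) :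
    IsNorm E x ↔ ∃ u, algebraMap E₀ E x = u * σ u := by
  constructor
  · rintro ⟨u, rfl⟩
    exact ⟨u, norm_eq hσ _⟩
  · rintro ⟨u, hu⟩
    have hu0 : u ≠ 0 := by
      rintro rfl
      rw [zero_mul] at hu
      exact hx ((map_eq_zero _).1 hu)
    exact ⟨Units.mk0 u hu0, (algebraMap E₀ E).injective (by rw [hu, Units.val_mk0, norm_eq hσ])⟩

-- Squares of nonzero elements of `E₀` are norms.
omit [CharZero E] in
theorem isNorm_mul_sq_iff (x : E₀) {y : E₀} (hy : y ≠ 0) : IsNorm E (x * y ^ 2) ↔ IsNorm E x := by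
  have hN : ∀ z : E₀, Algebra.norm E₀ (algebraMap E₀ E z) = z ^ 2 := fun z => by
    rw [Algebra.norm_algebraMap, Algebra.IsQuadraticExtension.finrank_eq_two]
  have hne : ∀ {z : E₀}, z ≠ 0 → algebraMap E₀ E z ≠ 0 := fun hz => (map_ne_zero _).2 hz
  constructor
  · rintro ⟨u, hu⟩
    refine ⟨u * Units.mk0 _ (hne (inv_ne_zero hy)), ?_⟩
    rw [Units.val_mul, Units.val_mk0, map_mul, hu, hN, mul_assoc, ← mul_pow, mul_inv_cancel₀ hy,
      one_pow, mul_one]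
  · rintro ⟨u, hu⟩
    refine ⟨u * Units.mk0 _ (hne hy), ?_⟩
    rw [Units.val_mul, Units.val_mk0, map_mul, hu, hN]

variable {G V : Type*} [Group G] [AddCommGroup V] [Module E V]

/-- Galois descent for representations along a quadratic extension. -/
theorem definedOver_of_involution [Module.Finite E V] (hσ : σ ≠ AlgEquiv.refl)
    (ρ : Representation E G V) (j : V →ₛₗ[(σ : E →+* E)] V) (hj : ∀ x, j (j x) = x)
    (hjρ : ∀ g x, j (ρ g x) = ρ g (j x)) : DefinedOver E₀ ρ := by
  obtain ⟨δ, hδ, hδ0⟩ := exists_antiinvariant hσ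
  let _ : Module E₀ V := Module.compHom V (algebraMap E₀ E)
  have hsmul : ∀ (c : E₀) (x : V), c • x = algebraMap E₀ E c • x := fun _ _ => rfl
  have _ : IsScalarTower E₀ E V := ⟨fun c d x => by
    rw [hsmul, smul_smul, Algebra.smul_def]⟩
  have hjδ : ∀ x, j (δ • x) = -(δ • j x) := fun x => by
    rw [map_smulₛₗ, ← neg_smul]
    exact congrArg (· • _) hδ
  -- The `E₀`-form is the fixed space of `j`.
  let V₀ : Submodule E₀ V :=
    { carrier := {x | j x = x}
      add_mem' := fun {x y} hx hy => by
        change j (x + y) = x + y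
        rw [map_add, hx, hy]
      zero_mem' := map_zero j
      smul_mem' := fun c x hx => by
        change j (c • x) = c • x
        rw [hsmul, map_smulₛₗ, hx]
        exact congrArg (· • _) (σ.commutes c) }
  have hV₀ : ∀ x, x ∈ V₀ ↔ j x = x := fun _ => Iff.rfl
  have _ : Module.Finite E₀ V := Module.Finite.trans E V
  let f : E ⊗[E₀] V₀ →ₗ[E] V := V₀.subtype.liftBaseChange E
  have hf : ∀ (c : E) (x : V₀), f (c ⊗ₜ x) = c • (x : V) := fun c x => by
    simp [f]
  have hform : ∀ t : E ⊗[E₀] V₀, ∃ x y : V₀, t = 1 ⊗ₜ x + δ ⊗ₜ y := by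
    intro t
    induction t with
    | zero => exact ⟨0, 0, by simp⟩
    | tmul c x =>
      obtain ⟨y, z, rfl⟩ := exists_eq_add_mul hσ hδ hδ0 c
      refine ⟨y • x, z • x, ?_⟩
      rw [TensorProduct.add_tmul, Algebra.algebraMap_eq_smul_one, ← Algebra.smul_def,
        TensorProduct.smul_tmul, TensorProduct.smul_tmul]
    | add s t hs ht =>
      obtain ⟨x, y, rfl⟩ := hs
      obtain ⟨x', y', rfl⟩ := ht
      refine ⟨x + x', y + y', ?_⟩
      rw [TensorProduct.tmul_add, TensorProduct.tmul_add]
      abel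
  have hfinj : Function.Injective f := by
    rw [injective_iff_map_eq_zero]
    intro t ht
    obtain ⟨⟨x, hx⟩, ⟨y, hy⟩, rfl⟩ := hform t
    rw [map_add, hf, hf, one_smul] at ht
    change x + δ • y = 0 at ht
    have ht' := congrArg j ht
    rw [map_add, hjδ, (hV₀ x).1 hx, (hV₀ y).1 hy, map_zero] at ht'
    have hx0 : (2 : E) • x = 0 := by
      rw [two_smul]
      calc x + x = (x + δ • y) + (x + -(δ • y)) := by abel
        _ = 0 := by rw [ht, ht', add_zero]
    have hx0' : x = 0 := (smul_eq_zero.1 hx0).resolve_left two_ne_zero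
    rw [hx0', zero_add] at ht
    have hy0 : y = 0 := (smul_eq_zero.1 ht).resolve_left hδ0
    subst hx0' hy0
    have hz : ∀ h : (0 : V) ∈ V₀, (⟨0, h⟩ : V₀) = 0 := fun _ => rfl
    rw [hz, TensorProduct.tmul_zero, TensorProduct.tmul_zero, add_zero]
  have hfsurj : Function.Surjective f := by
    intro x
    -- The decomposition `V = V₀ ⊕ δ V₀`: the components of `x` are `(x + j x) / 2` and `δ` times
    -- `(x - j x) / (2δ)`.
    have h1 : (2 : E)⁻¹ • (x + j x) ∈ V₀ := by
      rw [hV₀, map_smulₛₗ, map_add, hj, add_comm]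
      exact congrArg (· • _) (by rw [RingHom.coe_coe, map_inv₀, map_ofNat])
    have h2 : (2 * δ)⁻¹ • (x - j x) ∈ V₀ := by
      rw [hV₀, map_smulₛₗ, map_sub, hj, ← neg_sub, smul_neg, ← neg_smul]
      refine congrArg (· • _) ?_
      rw [RingHom.coe_coe, map_inv₀, map_mul, map_ofNat, hδ, mul_neg, inv_neg, neg_neg]
    refine ⟨1 ⊗ₜ ⟨_, h1⟩ + δ ⊗ₜ ⟨_, h2⟩, ?_⟩
    rw [map_add, hf, hf, one_smul]
    change (2 : E)⁻¹ • (x + j x) + δ • (2 * δ)⁻¹ • (x - j x) = x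
    match_scalars <;> field_simp <;> norm_num
  let ρV : Representation E₀ G V₀ :=
    { toFun g := ((ρ g).restrictScalars E₀).restrict fun x hx => by
        rw [hV₀] at hx ⊢
        change j (ρ g x) = ρ g x
        rw [hjρ, hx]
      map_one' := by ext x; simp
      map_mul' g h := by ext x; simp }
  have hρV : ∀ g (x : V₀), ((ρV g x : V₀) : V) = ρ g x := fun _ _ => rfl
  let κ : V₀ ≃ₗ[E₀] (Fin (Module.finrank E₀ V₀) → E₀) := (Module.finBasis E₀ V₀).equivFun
  refine ⟨Module.finrank E₀ V₀,
    { toFun g := κ.toLinearMap ∘ₗ ρV g ∘ₗ κ.symm.toLinearMap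
      map_one' := by ext; simp
      map_mul' g h := by ext; simp },
    (κ.symm.baseChange E₀ E _ _).trans (LinearEquiv.ofBijective f ⟨hfinj, hfsurj⟩), ?_⟩
  intro g x
  induction x with
  | zero => simp
  | add x y hx hy => simp only [map_add, hx, hy]
  | tmul c x =>
    change f (c ⊗ₜ κ.symm (κ (ρV g (κ.symm x)))) = ρ g (f (c ⊗ₜ κ.symm x))
    rw [κ.symm_apply_apply, hf, hf, hρV, map_smul]

/-- A representation that is defined over the subfield has a semilinear involution. -/
theorem DefinedOver.exists_involution (σ : E ≃ₐ[E₀] E) {ρ : Representation E G V}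
    (h : DefinedOver E₀ ρ) : ∃ j : V →ₛₗ[(σ : E →+* E)] V, (∀ x, j (j x) = x) ∧
      ∀ g x, j (ρ g x) = ρ g (j x) := by
  obtain ⟨d, ρ₀, Φ, hΦ⟩ := h
  -- The involution is conjugation on the factor `E`, transported by `Φ`.
  let c : E ⊗[E₀] (Fin d → E₀) →ₗ[E₀] E ⊗[E₀] (Fin d → E₀) :=
    TensorProduct.map σ.toLinearMap LinearMap.id
  have hc : ∀ z x, c (z ⊗ₜ x) = σ z ⊗ₜ x := fun _ _ => rfl
  have hcs : ∀ (z : E) t, c (z • t) = σ z • c t := by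
    intro z t
    induction t with
    | zero => simp
    | add s t hs ht => rw [smul_add, map_add, hs, ht, map_add, smul_add]
    | tmul y x => rw [TensorProduct.smul_tmul', hc, hc, TensorProduct.smul_tmul', smul_eq_mul,
        smul_eq_mul, map_mul]
  have hcc : ∀ t, c (c t) = t := by
    intro t
    induction t with
    | zero => simp
    | add s t hs ht => rw [map_add, map_add, hs, ht]
    | tmul y x => rw [hc, hc, conj_conj]
  have hcρ : ∀ g t, c ((ρ₀ g).baseChange E t) = (ρ₀ g).baseChange E (c t) := by
    intro g t
    induction t with
    | zero => simp
    | add s t hs ht => simp only [map_add, hs, ht]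
    | tmul y x => rfl
  refine ⟨{ toFun x := Φ (c (Φ.symm x))
            map_add' x y := by simp only [map_add]
            map_smul' z x := by
              rw [map_smul, hcs, map_smul]
              rfl }, fun x => ?_, fun g x => ?_⟩
  · change Φ (c (Φ.symm (Φ (c (Φ.symm x))))) = x
    rw [Φ.symm_apply_apply, hcc, Φ.apply_symm_apply]
  · change Φ (c (Φ.symm (ρ g x))) = ρ g (Φ (c (Φ.symm x)))
    rw [← hΦ, ← hcρ]
    congr 2
    rw [Φ.symm_apply_eq, hΦ, Φ.apply_symm_apply]

end Quadratic

/-! ### The rationality criterion for each half spin module -/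

section Rationality

variable {E₀ E W : Type*} [Field E₀] [Field E] [Algebra E₀ E] [AddCommGroup W] [Module E W]
  [NeZero (2 : E)] {σ : E ≃ₐ[E₀] E}

/-- Used to extend an endomorphism of one half spin module by zero to the whole spin module, keeping
commutation with `G₁`. -/
theorem exists_projection {n : ℕ} {b : LinearMap.BilinForm E W}
    {e : Module.Basis (Fin n ⊕ Fin n) E W} (h : IsStandardBasis b e) (ε : ZMod 2) :
    ∃ π : Module.End E (ExteriorAlgebra E (W₁ e)), (∀ x, π x ∈ S e ε) ∧ (∀ x ∈ S e ε, π x = x) ∧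
      (∀ x ∈ S e (1 + ε), π x = 0) ∧ ∀ g ∈ CliffordAlgebra.evenOdd (quad b) 0, ∀ x,
        π (spinAction h g x) = spinAction h g (π x) := by
  have hcomm : ∀ c d : E, ∀ g ∈ CliffordAlgebra.evenOdd (quad b) 0, ∀ x,
      parityScale e c d (spinAction h g x) = spinAction h g (parityScale e c d x) := by
    intro c d g hg x
    obtain ⟨y, hy, z, hz, rfl⟩ := exists_even_add_odd x
    rw [map_add, parityScale_add c d hy hz,
      parityScale_add c d (spinAction_mem h hg hy) (spinAction_mem h hg hz), map_add, map_smul,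
      map_smul]
  fin_cases ε
  · refine ⟨parityScale e 1 0, fun x => ?_, fun x hx => ?_, fun x hx => ?_, hcomm 1 0⟩
    · obtain ⟨y, hy, z, hz, rfl⟩ := exists_even_add_odd x
      rw [parityScale_add _ _ hy hz, one_smul, zero_smul, add_zero]
      exact hy
    · rw [parityScale_even _ _ hx, one_smul]
    · rw [parityScale_odd 1 0 hx, zero_smul]
  · refine ⟨parityScale e 0 1, fun x => ?_, fun x hx => ?_, fun x hx => ?_, hcomm 0 1⟩
    · obtain ⟨y, hy, z, hz, rfl⟩ := exists_even_add_odd x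
      rw [parityScale_add _ _ hy hz, one_smul, zero_smul, zero_add]
      exact hz
    · rw [parityScale_odd _ _ hx, one_smul]
    · rw [parityScale_even 0 1 hx, zero_smul]

theorem exists_ne_zero_mem {n : ℕ} [NeZero n] {b : LinearMap.BilinForm E W}
    {e : Module.Basis (Fin n ⊕ Fin n) E W} (h : IsStandardBasis b e) (ε : ZMod 2) :
    ∃ x ∈ S e ε, x ≠ 0 := by
  fin_cases ε
  · exact ⟨1, one_mem_even, one_ne_zero⟩
  · refine ⟨vectorAction b e (e (.inl 0)) 1, vectorAction_mem_odd _ one_mem_even, fun h0 => ?_⟩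
    have := vectorAction_anticomm h (e (.inr 0)) (e (.inl 0)) 1
    rw [vectorAction_inr_one, h0, map_zero, map_zero, add_zero, h.apply_basis_left, Sum.swap_inr,
      Module.Basis.repr_self, Finsupp.single_eq_same, one_smul] at this
    exact zero_ne_one this

variable [CharZero E] [Algebra.IsQuadraticExtension E₀ E] [Module E₀ W] [IsScalarTower E₀ E W]
  {m : ℕ} {b : LinearMap.BilinForm E W}
  {ψ : W →ₗ[E] W →ₛₗ[(σ : E →+* E)] E} {lam : E₀}
  {e : Module.Basis (Fin (2 * m) ⊕ Fin (2 * m)) E W} {a : Fin (2 * m) ⊕ Fin (2 * m) → E₀}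

/-- A half spin representation is defined over `E₀` if and only if the scalar attached to it is
a norm. -/
theorem definedOver_halfSpinG₁_iff (hσ : σ ≠ AlgEquiv.refl) (hm : 1 ≤ m)
    (he : IsGoodBasis b ψ e a lam) (hlam : lam ≠ 0) (ε : ZMod 2) :
    DefinedOver E₀ (halfSpinG₁ ψ he.standard ε) ↔
      IsNorm E (spinScalar m (∏ i, a (.inl i)) lam ε) := by
  have : CharZero E₀ := charZero_of_algebra E₀ E
  have : NeZero (2 * m) := ⟨by omega⟩
  have hσσ := conj_conj σ
  obtain ⟨F, hF⟩ := exists_spinJ he hlam hσσ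
  have hc0 := he.spinScalar_ne_zero hlam m ε
  rw [isNorm_iff hσ hc0]
  set c := spinScalar m (∏ i, a (.inl i)) lam ε with hc
  let Fε : S e ε →ₛₗ[(σ : E →+* E)] S e ε :=
    { toFun x := ⟨F x, hF.mem ε _ x.2⟩
      map_add' x y := Subtype.ext (map_add F _ _)
      map_smul' r x := Subtype.ext (map_smulₛₗ F r _) }
  have hFsq : ∀ x, Fε (Fε x) = algebraMap E₀ E c • x := fun x => Subtype.ext (hF.sq ε _ x.2)
  have hFρ : ∀ g x, Fε (halfSpinG₁ ψ he.standard ε g x) = halfSpinG₁ ψ he.standard ε g (Fε x) :=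
    fun g x => Subtype.ext (hF.commute_G₁ he hlam hσσ g.2 x)
  constructor
  · intro h
    obtain ⟨j, hj, hjρ⟩ := h.exists_involution σ
    obtain ⟨δ, hδ, hδ0⟩ := exists_antiinvariant hσ
    obtain ⟨d, hd⟩ := exists_of_conj_eq hσ (x := δ ^ 2) (by rw [map_pow, hδ, neg_sq])
    obtain ⟨π, hπmem, hπ1, hπ0, hπγ⟩ := exists_projection he.standard ε
    -- The operator `j F`, extended by zero. It is linear, as the composite of two semilinear maps.
    let A : Module.End E (ExteriorAlgebra E (W₁ e)) :=
      { toFun x := (j (Fε ⟨π x, hπmem x⟩) : S e ε)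
        map_add' x y := by
          have h1 : (⟨π (x + y), hπmem _⟩ : S e ε) = ⟨π x, hπmem x⟩ + ⟨π y, hπmem y⟩ :=
            Subtype.ext (map_add π x y)
          rw [h1, map_add, map_add, Submodule.coe_add]
        map_smul' r x := by
          have h1 : (⟨π (r • x), hπmem _⟩ : S e ε) = r • ⟨π x, hπmem x⟩ :=
            Subtype.ext (map_smul π r x)
          rw [h1, map_smulₛₗ, map_smulₛₗ, ← Submodule.coe_smul]
          exact congrArg Subtype.val (congrArg (· • j (Fε ⟨π x, hπmem x⟩)) (hσσ r)) }
    have hAdef : ∀ x, A x = (j (Fε ⟨π x, hπmem x⟩) : S e ε) := fun _ => rfl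
    obtain ⟨u, hu⟩ := exists_smul_of_commute_G₁ he hlam hm hσσ hδ hδ0 hd (A := A)
      (fun g hg => LinearMap.ext fun x => by
        have h1 : (⟨π (spinAction he.standard g x), hπmem _⟩ : S e ε) =
            halfSpinG₁ ψ he.standard ε ⟨g, hg⟩ ⟨π x, hπmem x⟩ :=
          Subtype.ext (hπγ _ (spinGroup.mem_even g.2) x)
        rw [Module.End.mul_apply, Module.End.mul_apply, hAdef, hAdef, h1, hFρ, hjρ]
        rfl) ε
      (fun x hx => by
        have h1 : (⟨π x, hπmem x⟩ : S e ε) = 0 := Subtype.ext (hπ0 x hx)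
        rw [hAdef, h1, map_zero, map_zero, Submodule.coe_zero])
    have hju : ∀ y : S e ε, j (Fε y) = u • y := by
      intro y
      refine Subtype.ext ?_
      have h1 : (⟨π y, hπmem y⟩ : S e ε) = y := Subtype.ext (hπ1 y y.2)
      rw [Submodule.coe_smul, ← hu y y.2, hAdef, h1]
    have hFu : ∀ y : S e ε, Fε y = σ u • j y := by
      intro y
      rw [← hj (Fε y), hju, map_smulₛₗ]
      rfl
    obtain ⟨x, hx, hx0⟩ := exists_ne_zero_mem he.standard ε
    have h1 := hFsq ⟨x, hx⟩
    rw [hFu, hju, smul_smul] at h1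
    have h2 : (σ u * u - algebraMap E₀ E c) • x = 0 := by
      rw [sub_smul, sub_eq_zero]
      exact congrArg Subtype.val h1
    refine ⟨u, ?_⟩
    rw [mul_comm]
    exact (sub_eq_zero.1 ((smul_eq_zero.1 h2).resolve_right hx0)).symm
  · rintro ⟨u, hu⟩
    have hu0 : u ≠ 0 := by
      rintro rfl
      rw [zero_mul] at hu
      exact hc0 ((map_eq_zero _).1 hu)
    have hσu0 : σ u ≠ 0 := (map_ne_zero _).2 hu0
    -- `(u⁻¹ F)² = (u σ(u))⁻¹ F²`, which is the identity.
    refine definedOver_of_involution hσ _ (u⁻¹ • Fε) (fun x => ?_) fun g x => ?_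
    · rw [LinearMap.smul_apply, LinearMap.smul_apply, map_smulₛₗ, hFsq, hu, smul_smul, smul_smul,
        RingHom.coe_coe, map_inv₀]
      have : u⁻¹ * (σ u)⁻¹ * (u * σ u) = 1 := by field_simp
      rw [this, one_smul]
    · rw [LinearMap.smul_apply, LinearMap.smul_apply, hFρ, map_smul]

omit [NeZero (2 : E)] [CharZero E] [Algebra.IsQuadraticExtension E₀ E] [Module E₀ W]
  [IsScalarTower E₀ E W] in
theorem IsGoodBasis.lam_ne_zero (he : IsGoodBasis b ψ e a lam) (hψ : ψ.Nondegenerate)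
    (hm : 1 ≤ m) : lam ≠ 0 := by
  have ha : ∀ r, a r ≠ 0 := by
    intro r hr
    refine e.ne_zero r (hψ.1 _ fun w => ?_)
    rw [he.diagonal]
    refine Finset.sum_eq_zero fun s _ => ?_
    by_cases hs : s = r
    · rw [hs, hr, map_zero, zero_mul, zero_mul]
    · rw [Module.Basis.repr_self, Finsupp.single_eq_of_ne hs, mul_zero, zero_mul]
  rw [← he.mul_eq ⟨0, by omega⟩]
  exact mul_ne_zero (ha _) (ha _)

-- For even `m` the factor `λ^{-m}` is a square and drops out.
omit [NeZero (2 : E)] [CharZero E] in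
theorem isNorm_spinScalar_of_even (hm : Even m) (D : E₀) (hlam : lam ≠ 0) :
    (IsNorm E (spinScalar m D lam 0) ↔ IsNorm E ((-1) ^ m * D)) ∧
      (IsNorm E (spinScalar m D lam 1) ↔ IsNorm E ((-1) ^ m * D * lam)) := by
  obtain ⟨k, rfl⟩ := hm
  rw [spinScalar_zero, spinScalar_one,
    ← isNorm_mul_sq_iff ((-1) ^ (k + k) * D) (pow_ne_zero k (inv_ne_zero hlam)),
    ← isNorm_mul_sq_iff ((-1) ^ (k + k) * D * lam) (pow_ne_zero k (inv_ne_zero hlam)),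
    pow_add lam⁻¹, ← pow_two, mul_right_comm _ _ lam]
  exact ⟨Iff.rfl, Iff.rfl⟩

-- For odd `m` the factor `λ^{-m}` is `λ` times a square, which exchanges the roles of the two half
-- spin modules.
omit [NeZero (2 : E)] [CharZero E] in
theorem isNorm_spinScalar_of_odd (hm : Odd m) (D : E₀) (hlam : lam ≠ 0) :
    (IsNorm E (spinScalar m D lam 0) ↔ IsNorm E ((-1) ^ m * D * lam)) ∧
      (IsNorm E (spinScalar m D lam 1) ↔ IsNorm E ((-1) ^ m * D)) := by
  obtain ⟨k, rfl⟩ := hm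
  rw [spinScalar_zero, spinScalar_one,
    ← isNorm_mul_sq_iff ((-1) ^ (2 * k + 1) * D) (pow_ne_zero k (inv_ne_zero hlam)),
    ← isNorm_mul_sq_iff ((-1) ^ (2 * k + 1) * D * lam) (pow_ne_zero (k + 1) (inv_ne_zero hlam))]
  have h1 : lam⁻¹ ^ (2 * k + 1) = lam * (lam⁻¹ ^ (k + 1)) ^ 2 := by
    rw [← pow_mul, show (k + 1) * 2 = 2 * k + 1 + 1 by ring, pow_succ _ (2 * k + 1)]
    field_simp
  have h2 : lam⁻¹ ^ (2 * k + 1) * lam = (lam⁻¹ ^ k) ^ 2 := by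
    rw [← pow_mul, mul_comm k 2, pow_succ, mul_assoc, inv_mul_cancel₀ hlam, mul_one]
  rw [mul_assoc _ (lam⁻¹ ^ (2 * k + 1)) lam, h2, h1, ← mul_assoc _ lam]
  exact ⟨Iff.rfl, Iff.rfl⟩

end Rationality

end HalfSpin

/-! ### The main theorem -/

open HalfSpin in
theorem mainTheorem4 {E₀ E W : Type*} [Field E₀] [Field E] [CharZero E] [Algebra E₀ E]
    [Algebra.IsQuadraticExtension E₀ E]
    (hE : (NumberField E₀ ∧ NumberField.IsTotallyReal E₀ ∧ NumberField.IsTotallyComplex E) ∨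
      Nonempty (E₀ ≃+* ℝ))
    (σ : E ≃ₐ[E₀] E) (hσ : σ ≠ AlgEquiv.refl)
    [AddCommGroup W] [Module E W] [Module E₀ W] [IsScalarTower E₀ E W]
    (m : ℕ) (hm : 1 ≤ m)
    (b : LinearMap.BilinForm E W) (ψ : W →ₗ[E] W →ₛₗ[(σ : E →+* E)] E) (hψ : ψ.Nondegenerate)
    (e : Module.Basis (Fin (2 * m) ⊕ Fin (2 * m)) E W) (a : Fin (2 * m) ⊕ Fin (2 * m) → E₀)
    (lam : E₀) (he : IsGoodBasis b ψ e a lam)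
    (D : E₀) (hD : D = ∏ i, a (.inl i)) :
    (DefinedOver E₀ (halfSpinG₁ ψ he.standard 0) ∧
        DefinedOver E₀ (halfSpinG₁ ψ he.standard 1) ↔
      IsNorm E ((-1) ^ m * D) ∧ IsNorm E ((-1) ^ m * D * lam)) ∧
    (DefinedOver E₀ (halfSpinG₁ ψ he.standard 0) ∧
        ¬ DefinedOver E₀ (halfSpinG₁ ψ he.standard 1) ↔
      (Even m ∧ IsNorm E ((-1) ^ m * D) ∧ ¬ IsNorm E ((-1) ^ m * D * lam)) ∨
      (Odd m ∧ ¬ IsNorm E ((-1) ^ m * D) ∧ IsNorm E ((-1) ^ m * D * lam))) ∧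
    (DefinedOver E₀ (halfSpinG₁ ψ he.standard 1) ∧
        ¬ DefinedOver E₀ (halfSpinG₁ ψ he.standard 0) ↔
      (Odd m ∧ IsNorm E ((-1) ^ m * D) ∧ ¬ IsNorm E ((-1) ^ m * D * lam)) ∨
      (Even m ∧ ¬ IsNorm E ((-1) ^ m * D) ∧ IsNorm E ((-1) ^ m * D * lam))) ∧
    (¬ DefinedOver E₀ (halfSpinG₁ ψ he.standard 0) ∧
        ¬ DefinedOver E₀ (halfSpinG₁ ψ he.standard 1) ↔
      ¬ IsNorm E ((-1) ^ m * D) ∧ ¬ IsNorm E ((-1) ^ m * D * lam)) := by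
  subst hD
  have hlam := he.lam_ne_zero hψ hm
  rw [definedOver_halfSpinG₁_iff hσ hm he hlam 0, definedOver_halfSpinG₁_iff hσ hm he hlam 1]
  rcases Nat.even_or_odd m with hpar | hpar
  · have hpar' : ¬ Odd m := Nat.not_odd_iff_even.2 hpar
    obtain ⟨h0, h1⟩ := isNorm_spinScalar_of_even (E := E) hpar (∏ i, a (.inl i)) hlam
    rw [h0, h1]
    tauto
  · have hpar' : ¬ Even m := Nat.not_even_iff_odd.2 hpar
    obtain ⟨h0, h1⟩ := isNorm_spinScalar_of_odd (E := E) hpar (∏ i, a (.inl i)) hlam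
    rw [h0, h1]
    tauto
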